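/- \textbf{Setting.} Let $X$ be a complex manifold with a holomorphic action of $(\mathbb{C}^*)^k$, and let $\mathbb{C}^k\ltimes X$ be the action groupoid of the induced action of $\mathbb{C}^k$ through the coordinatewise exponential. A \emph{homogeneous groupoid} $(\mathcal{G},i,\pi)$ over $X$ is a source-connected holomorphic Lie groupoid $\mathcal{G}$ over $X$ with source $s$ and target $t$, together with holomorphic groupoid morphisms $i:\mathbb{C}^k\ltimes X\to\mathcal{G}$ (over $\mathrm{id}_X$) and $\pi:\mathcal{G}\to\mathbb{C}^k$ such that $\pi(i(z,x))=z$; such that $i(2\pi i\,n,t(g))\,g=g\,i(2\pi i\,n,s(g))$ for all $n\in\mathbb{Z}^k$ and $g\in\mathcal{G}$; and such that $X$ has exactly one class for the equivalence relation generated by ``the closures of the $\mathcal{G}$-orbits of $x$ and $y$ intersect''. Let $H$ be a connected complex reductive Lie group; semisimple and unipotent elements of $H$, logarithms of unipotent elements and their exponentials are taken in a faithful representation of $H$. An object of $\mathrm{Rep}(\mathcal{G},H)$ is a pair $(P,\phi)$ of a holomorphic right principal $H$-bundle $P\to X$ and a holomorphic groupoid morphism $\phi:\mathcal{G}\to(P\times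 P)/H$ over $\mathrm{id}_X$ to the Atiyah groupoid, i.e. $\phi(g):P_{s(g)}\to P_{t(g)}$ is an $H$-equivariant map; morphisms are principal bundle maps over $\mathrm{id}_X$ which intertwine the representations. The \emph{monodromy} of $\phi$ is $M_n(x)=\phi(i(2\pi i\,n,x))\in\mathrm{Aut}_H(P_x)\cong H$, for $n\in\mathbb{Z}^k$. Let $\mathcal{JC}_H$ be the category of triples $(P,\phi_s,U)$, where $(P,\phi_s)\in\mathrm{Rep}(\mathcal{G},H)$ has semisimple monodromy and $U:\mathbb{Z}^k\to\mathrm{Aut}(\phi_s)$ is a homomorphism with unipotent values; morphisms are principal bundle maps intertwining both the representations and the automorphisms $U_n$. For a homomorphism $V$ from $\mathbb{Z}^k$ to the unipotent automorphisms of a representation on $P$, put \[\sigma_V(g)=\exp\Big(\frac{-1}{2\pi i}\sum_{j=1}^k\pi(g)_j\,\log V_{e_j}(t(g))\Big)\in\mathrm{Aut}_H(P_{t(g)}),\qquad g\in\mathcal{G},\] where $e_1,\dots,e_k$ is the standard basis of $\mathbb{Z}^k$. \textbf{Theorem.} Let $(\mathcal{G},i,\pi)$ be a homogeneous groupoid over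 $X$ and $H$ a connected complex reductive Lie group. There is an isomorphism of categories \[T:\mathrm{Rep}(\mathcal{G},H)\;\cong\;\mathcal{JC}_H\] which is the identity on underlying principal bundles and bundle maps. It is given by $T(P,\phi)=(P,\phi_s,U)$, where $U_n$ is the unipotent component of the monodromy $M_n$ of $\phi$ in the multiplicative Jordan--Chevalley decomposition and $\phi_s=\sigma_U\,\phi$; here $\sigma_U$ is a holomorphic $1$-cocycle valued in $(P,\phi)$, that is, $\sigma_U(gh)=\sigma_U(g)\,\phi(g)\,\sigma_U(h)\,\phi(g)^{-1}$ for composable $g,h$, and the monodromy of $\phi_s$ is the semisimple component of that of $\phi$. The inverse is $T^{-1}(P,\phi_s,U)=(P,\sigma_{U^{-1}}\phi_s)$, where $\sigma_{U^{-1}}$ is a holomorphic $1$-cocycle valued in $(P,\phi_s)$. -/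

import Mathlib

/-!
Holomorphic Lie groupoids, homogeneous groupoids, principal bundles, Atiyah groupoids and
representations.  "Holomorphic" means complex analytic, i.e. `ContMDiff … ω` over `ℂ`.
-/

open CategoryTheory Manifold
open scoped ContDiff Topology

universe w

noncomputable section

namespace JCDec

/-! ### Holomorphic Lie groupoids -/

section Groupoids

variable (E EG X G : Type*)
  [NormedAddCommGroup E] [NormedSpace ℂ E] [NormedAddCommGroup EG] [NormedSpace ℂ EG]
  [TopologicalSpace X] [ChartedSpace E X] [TopologicalSpace G] [ChartedSpace EG G]

/-- A holomorphic Lie groupoid with manifold of objects `X` and (possibly non-Hausdorff) manifold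
of arrows `G`.  The product `mul g h` is meaningful only when `src g = tgt h`; its values on other
pairs are irrelevant and nothing is required of them.  As `src` is a submersion, the composable
pairs form an embedded submanifold of `G × G`, and `ContMDiffOn` on that set is
holomorphy on this submanifold. -/
structure HolLieGroupoid where
  /-- source -/
  src : G → X
  /-- target -/
  tgt : G → X
  /-- identity arrows -/
  one : X → G
  /-- inverse arrows -/
  inv : G → G
  /-- composition `g h` (first `h`, then `g`) -/
  mul : G → G → G
  src_one : ∀ x, src (one x) = x
  tgt_one : ∀ x, tgt (one x) = x
  src_inv : ∀ g, src (inv g) = tgt g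
  tgt_inv : ∀ g, tgt (inv g) = src g
  src_mul : ∀ g h, src g = tgt h → src (mul g h) = src h
  tgt_mul : ∀ g h, src g = tgt h → tgt (mul g h) = tgt g
  mul_assoc : ∀ g h l, src g = tgt h → src h = tgt l → mul (mul g h) l = mul g (mul h l)
  one_mul : ∀ g, mul (one (tgt g)) g = g
  mul_one : ∀ g, mul g (one (src g)) = g
  inv_mul : ∀ g, mul (inv g) g = one (src g)
  mul_inv : ∀ g, mul g (inv g) = one (tgt g)
  src_submersion : IsSubmersion 𝓘(ℂ, EG) 𝓘(ℂ, E) ω src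
  tgt_submersion : IsSubmersion 𝓘(ℂ, EG) 𝓘(ℂ, E) ω tgt
  one_holomorphic : ContMDiff 𝓘(ℂ, E) 𝓘(ℂ, EG) ω one
  inv_holomorphic : ContMDiff 𝓘(ℂ, EG) 𝓘(ℂ, EG) ω inv
  mul_holomorphic : ContMDiffOn (𝓘(ℂ, EG).prod 𝓘(ℂ, EG)) 𝓘(ℂ, EG) ω
    (fun a : G × G => mul a.1 a.2) {a | src a.1 = tgt a.2}

variable {E EG X G}

/-- The orbit of a point of the base. -/
def HolLieGroupoid.orbit (𝒢 : HolLieGroupoid E EG X G) (x : X) : Set X :=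
  {y | ∃ g, 𝒢.src g = x ∧ 𝒢.tgt g = y}

/-- s-equivalence: the equivalence relation generated by "the orbit closures intersect". -/
def HolLieGroupoid.SEquiv (𝒢 : HolLieGroupoid E EG X G) : X → X → Prop :=
  Relation.EqvGen fun x y => (closure (𝒢.orbit x) ∩ closure (𝒢.orbit y)).Nonempty

/-- The coordinatewise exponential `ℂ^k → (ℂ^*)^k`. -/
def expTorus {k : ℕ} (z : Fin k → ℂ) : Fin k → ℂˣ :=
  fun j => Units.mk0 (Complex.exp (z j)) (Complex.exp_ne_zero _)

/-- The lattice vector `2πi n` in the kernel of the exponential. -/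
def lattice {k : ℕ} (n : Fin k → ℤ) : Fin k → ℂ :=
  fun j => 2 * Real.pi * Complex.I * n j

variable (E EG X G)

/-- A homogeneous groupoid over a complex manifold `X` with a holomorphic action of `(ℂ^*)^k`:
a source-connected holomorphic Lie groupoid with morphisms `i : ℂ^k ⋉ X → 𝒢` (over the identity
of `X`) and `π : 𝒢 → ℂ^k` such that `π ∘ i` is the projection, the lattice `2πi ℤ^k × X` is central
in `𝒢`, and there is exactly one s-equivalence class. -/
structure HomogeneousGroupoid (k : ℕ) [MulAction (Fin k → ℂˣ) X]
    extends HolLieGroupoid E EG X G where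
  torus_action_holomorphic :
    ContMDiff ((ModelWithCorners.pi fun _ : Fin k => 𝓘(ℂ, ℂ)).prod 𝓘(ℂ, E)) 𝓘(ℂ, E) ω
      (fun a : (Fin k → ℂˣ) × X => a.1 • a.2)
  source_connected : ∀ x, IsConnected {g | src g = x}
  /-- the morphism `i` out of the action groupoid `ℂ^k ⋉ X` -/
  i : (Fin k → ℂ) × X → G
  i_holomorphic : ContMDiff (𝓘(ℂ, Fin k → ℂ).prod 𝓘(ℂ, E)) 𝓘(ℂ, EG) ω i
  src_i : ∀ z x, src (i (z, x)) = x
  tgt_i : ∀ z x, tgt (i (z, x)) = expTorus z • x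
  i_zero : ∀ x, i (0, x) = one x
  i_add : ∀ z z' x, i (z + z', x) = mul (i (z, expTorus z' • x)) (i (z', x))
  /-- the morphism `π` to the abelian group `ℂ^k` -/
  π : G → (Fin k → ℂ)
  π_holomorphic : ContMDiff 𝓘(ℂ, EG) 𝓘(ℂ, Fin k → ℂ) ω π
  π_mul : ∀ g h, src g = tgt h → π (mul g h) = π g + π h
  π_i : ∀ z x, π (i (z, x)) = z
  central : ∀ (n : Fin k → ℤ) (g : G),
    mul (i (lattice n, tgt g)) g = mul g (i (lattice n, src g))
  nonempty_base : Nonempty X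
  sEquiv_unique : ∀ x y : X, toHolLieGroupoid.SEquiv x y

end Groupoids

/-! ### Complex reductive groups -/

section Reductive

variable (F H : Type*) [NormedAddCommGroup F] [NormedSpace ℂ F]
  [TopologicalSpace H] [ChartedSpace F H] [Group H]

/-- A set of invertible matrices is Zariski closed if it is the zero locus, in the general linear
group, of a set of polynomials in the matrix entries. -/
def IsZariskiClosed {N : ℕ} (Z : Set (GL (Fin N) ℂ)) : Prop :=
  ∃ S : Set (MvPolynomial (Fin N × Fin N) ℂ),
    Z = {A : GL (Fin N) ℂ | ∀ f ∈ S, MvPolynomial.eval (fun a => (A : Matrix (Fin N) (Fin N) ℂ) a.1 a.2) f = 0}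

/-- A unipotent matrix. -/
def IsUnipotentMatrix {N : ℕ} (A : Matrix (Fin N) (Fin N) ℂ) : Prop := IsNilpotent (A - 1)

/-- The structure of a complex reductive group on a complex Lie group `H`: a faithful
representation `ρ` identifying `H` with a Zariski closed complex Lie subgroup of `GL_N(ℂ)`,
such that `H` has trivial unipotent radical. -/
structure ReductiveGroup where
  /-- dimension of the faithful representation -/
  N : ℕ
  /-- the faithful representation -/
  ρ : H →* GL (Fin N) ℂ
  embedding : IsSmoothEmbedding 𝓘(ℂ, F) 𝓘(ℂ, Fin N → Fin N → ℂ) ω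
    (fun h a b => (ρ h : Matrix (Fin N) (Fin N) ℂ) a b)
  zariskiClosed : IsZariskiClosed (Set.range ρ)
  unipotentRadical_trivial : ∀ K : Subgroup H, K.Normal → IsConnected (K : Set H) →
    IsZariskiClosed (ρ '' (K : Set H)) →
    (∀ h ∈ K, IsUnipotentMatrix (ρ h : Matrix (Fin N) (Fin N) ℂ)) → K = ⊥

variable {F H}

namespace ReductiveGroup

variable (R : ReductiveGroup F H)

/-- The matrix of an element of the group in the faithful representation. -/
def mat (h : H) : Matrix (Fin R.N) (Fin R.N) ℂ := (R.ρ h : Matrix (Fin R.N) (Fin R.N) ℂ)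

/-- Semisimple elements (over `ℂ`: the matrix is diagonalizable). -/
def IsSemisimple (h : H) : Prop := Module.End.IsSemisimple (Matrix.toLin' (R.mat h))

/-- Unipotent elements. -/
def IsUnipotent (h : H) : Prop := IsUnipotentMatrix (R.mat h)

/-- `m = s u` is the multiplicative Jordan–Chevalley decomposition of `m`. -/
def IsJordanChevalley (m s u : H) : Prop :=
  R.IsSemisimple s ∧ R.IsUnipotent u ∧ m = s * u ∧ s * u = u * s

/-- The logarithm of a unipotent element, as a matrix: the Taylor series of `log (1 + x)` at
`x = ρ(u) - 1`, whose terms of degree larger than `N` vanish. -/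
def log (u : H) : Matrix (Fin R.N) (Fin R.N) ℂ :=
  ∑ m ∈ Finset.range R.N, ((-1 : ℂ) ^ m / ((m : ℂ) + 1)) • (R.mat u - 1) ^ (m + 1)

/-- `c = exp (-1/(2πi) ∑ⱼ zⱼ log uⱼ)`, read in the faithful representation. -/
def IsExpLog {k : ℕ} (z : Fin k → ℂ) (u : Fin k → H) (c : H) : Prop :=
  R.mat c = NormedSpace.exp
    ((-1 / (2 * Real.pi * Complex.I) : ℂ) • ∑ j, z j • R.log (u j))

end ReductiveGroup

end Reductive

/-! ### Principal bundles -/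

section Bundles

variable (E X F H : Type*)
  [NormedAddCommGroup E] [NormedSpace ℂ E] [NormedAddCommGroup F] [NormedSpace ℂ F]
  [TopologicalSpace X] [ChartedSpace E X] [TopologicalSpace H] [ChartedSpace F H] [Group H]

/-- A holomorphic right principal `H`-bundle over `X`. -/
structure PrincipalBundle where
  /-- total space -/
  carrier : Type w
  [topology : TopologicalSpace carrier]
  [charted : ChartedSpace (ModelProd E F) carrier]
  [manifold : IsManifold (𝓘(ℂ, E).prod 𝓘(ℂ, F)) ω carrier]
  /-- bundle projection -/
  proj : carrier → X
  /-- right action of `H` -/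
  act : carrier → H → carrier
  act_one : ∀ p, act p 1 = p
  act_mul : ∀ p h h', act p (h * h') = act (act p h) h'
  proj_act : ∀ p h, proj (act p h) = proj p
  proj_holomorphic : ContMDiff (𝓘(ℂ, E).prod 𝓘(ℂ, F)) 𝓘(ℂ, E) ω proj
  act_holomorphic : ContMDiff ((𝓘(ℂ, E).prod 𝓘(ℂ, F)).prod 𝓘(ℂ, F)) (𝓘(ℂ, E).prod 𝓘(ℂ, F)) ω
    (fun a : carrier × H => act a.1 a.2)
  /-- equivariant biholomorphic local trivializations -/
  locally_trivial : ∀ x : X, ∃ W : Set X, IsOpen W ∧ x ∈ W ∧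
    ∃ e : OpenPartialHomeomorph carrier (X × H),
      e.source = proj ⁻¹' W ∧ e.target = W ×ˢ Set.univ ∧
      (∀ p ∈ e.source, (e p).1 = proj p) ∧
      (∀ p ∈ e.source, ∀ h, (e (act p h)).2 = (e p).2 * h) ∧
      ContMDiffOn (𝓘(ℂ, E).prod 𝓘(ℂ, F)) (𝓘(ℂ, E).prod 𝓘(ℂ, F)) ω e e.source ∧
      ContMDiffOn (𝓘(ℂ, E).prod 𝓘(ℂ, F)) (𝓘(ℂ, E).prod 𝓘(ℂ, F)) ω e.symm e.target

attribute [instance] PrincipalBundle.topology PrincipalBundle.charted PrincipalBundle.manifold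

variable {E X F H}

namespace PrincipalBundle

/-- Principal bundle maps: holomorphic `H`-equivariant maps over the identity of `X`. -/
@[ext]
structure Hom (P Q : PrincipalBundle.{w} E X F H) where
  /-- underlying map of total spaces -/
  toFun : P.carrier → Q.carrier
  holomorphic : ContMDiff (𝓘(ℂ, E).prod 𝓘(ℂ, F)) (𝓘(ℂ, E).prod 𝓘(ℂ, F)) ω toFun
  proj_toFun : ∀ p, Q.proj (toFun p) = P.proj p
  toFun_act : ∀ p h, toFun (P.act p h) = Q.act (toFun p) h

instance : Category (PrincipalBundle.{w} E X F H) where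
  Hom := Hom
  id P := ⟨id, contMDiff_id, fun _ => rfl, fun _ _ => rfl⟩
  comp f g := ⟨g.toFun ∘ f.toFun, g.holomorphic.comp f.holomorphic,
    fun p => (g.proj_toFun _).trans (f.proj_toFun p),
    fun p h => by simp [f.toFun_act, g.toFun_act]⟩

/-- The diagonal action of `H` on `P × P`, as an equivalence relation. -/
def pairSetoid (P : PrincipalBundle.{w} E X F H) : Setoid (P.carrier × P.carrier) where
  r a b := ∃ h : H, b = (P.act a.1 h, P.act a.2 h)
  iseqv :=
    { refl := fun a => ⟨1, by simp [P.act_one]⟩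
      symm := by
        rintro a b ⟨h, rfl⟩
        exact ⟨h⁻¹, by simp [← P.act_mul, P.act_one]⟩
      trans := by
        rintro a b c ⟨h, rfl⟩ ⟨h', rfl⟩
        exact ⟨h * h', by simp [P.act_mul]⟩ }

/-- The Atiyah groupoid `Pair(P)/H` of a principal bundle. -/
def Atiyah (P : PrincipalBundle.{w} E X F H) : Type w := Quotient P.pairSetoid

/-- The class `[q, p]` in the Atiyah groupoid: the `H`-equivariant map from the fibre
through `p` to the fibre through `q` that sends `p` to `q`. -/
def arrow (P : PrincipalBundle.{w} E X F H) (q p : P.carrier) : P.Atiyah :=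
  Quotient.mk P.pairSetoid (q, p)

namespace Atiyah

variable {P : PrincipalBundle.{w} E X F H}

/-- Source in the Atiyah groupoid. -/
def src (a : P.Atiyah) : X :=
  Quotient.liftOn a (fun b => P.proj b.2) (by rintro a b ⟨h, rfl⟩; simp [P.proj_act])

/-- Target in the Atiyah groupoid. -/
def tgt (a : P.Atiyah) : X :=
  Quotient.liftOn a (fun b => P.proj b.1) (by rintro a b ⟨h, rfl⟩; simp [P.proj_act])

/-- Inverse in the Atiyah groupoid. -/
def inv (a : P.Atiyah) : P.Atiyah :=
  Quotient.liftOn a (fun b => P.arrow b.2 b.1)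
    (by rintro a b ⟨h, rfl⟩; exact Quotient.sound ⟨h, rfl⟩)

/-- `IsComp a b c` says that `a` and `b` are composable with composite `a ∘ b = c`:
`[r, q] ∘ [q, p] = [r, p]`. -/
def IsComp (a b c : P.Atiyah) : Prop :=
  ∃ p q r, a = P.arrow r q ∧ b = P.arrow q p ∧ c = P.arrow r p

/-- Holomorphy of a map into the Atiyah groupoid.  As `P × P → Pair(P)/H` is a holomorphic
principal bundle, a map into the quotient is holomorphic exactly when it lifts locally to a
holomorphic map into `P × P`. -/
def IsHolomorphic (EG : Type*) {G : Type*} [NormedAddCommGroup EG] [NormedSpace ℂ EG]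
    [TopologicalSpace G] [ChartedSpace EG G] (f : G → P.Atiyah) : Prop :=
  ∀ g₀ : G, ∃ W : Set G, IsOpen W ∧ g₀ ∈ W ∧ ∃ a b : G → P.carrier,
    ContMDiffOn 𝓘(ℂ, EG) (𝓘(ℂ, E).prod 𝓘(ℂ, F)) ω a W ∧
    ContMDiffOn 𝓘(ℂ, EG) (𝓘(ℂ, E).prod 𝓘(ℂ, F)) ω b W ∧
    ∀ g ∈ W, f g = P.arrow (a g) (b g)

end Atiyah

end PrincipalBundle

/-! ### Representations -/

variable {EG G : Type*} [NormedAddCommGroup EG] [NormedSpace ℂ EG]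
  [TopologicalSpace G] [ChartedSpace EG G]

/-- A representation of `𝒢` on `P`: a homomorphism of holomorphic groupoids (over the identity
of `X`) from `𝒢` to the Atiyah groupoid of `P`. -/
@[ext]
structure RepOn (𝒢 : HolLieGroupoid E EG X G) (P : PrincipalBundle.{w} E X F H) where
  /-- underlying map of arrows -/
  toFun : G → P.Atiyah
  src_toFun : ∀ g, (toFun g).src = 𝒢.src g
  tgt_toFun : ∀ g, (toFun g).tgt = 𝒢.tgt g
  map_one : ∀ p, toFun (𝒢.one (P.proj p)) = P.arrow p p
  map_mul : ∀ g h, 𝒢.src g = 𝒢.tgt h → (toFun g).IsComp (toFun h) (toFun (𝒢.mul g h))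
  holomorphic : PrincipalBundle.Atiyah.IsHolomorphic EG toFun

/-- A 1-cocycle valued in the representation `φ`: a holomorphic section `σ` of the pullback by
the target map of the gauge groupoid (the isotropy of the Atiyah groupoid) with
`σ(gh) = σ(g) φ(g) σ(h) φ(g)⁻¹`. -/
structure IsOneCocycle {𝒢 : HolLieGroupoid E EG X G} {P : PrincipalBundle.{w} E X F H}
    (φ : RepOn 𝒢 P) (σ : G → P.Atiyah) : Prop where
  src_eq : ∀ g, (σ g).src = 𝒢.tgt g
  tgt_eq : ∀ g, (σ g).tgt = 𝒢.tgt g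
  holomorphic : PrincipalBundle.Atiyah.IsHolomorphic EG σ
  cocycle : ∀ g h, 𝒢.src g = 𝒢.tgt h → ∃ a b : P.Atiyah,
    (σ g).IsComp (φ.toFun g) a ∧ a.IsComp (σ h) b ∧
      b.IsComp (φ.toFun g).inv (σ (𝒢.mul g h))

variable (F H) in
/-- Objects of the category `Rep(𝒢, H)`. -/
structure GRep (𝒢 : HolLieGroupoid E EG X G) where
  /-- the principal bundle -/
  P : PrincipalBundle.{w} E X F H
  /-- the representation on it -/
  φ : RepOn 𝒢 P

namespace GRep

variable {𝒢 : HolLieGroupoid E EG X G}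

/-- Morphisms of representations: principal bundle maps intertwining the representations. -/
@[ext]
structure Hom (A B : GRep.{w} F H 𝒢) where
  /-- underlying bundle map -/
  map : A.P ⟶ B.P
  intertwines : ∀ g q p, A.φ.toFun g = A.P.arrow q p →
    B.φ.toFun g = B.P.arrow (map.toFun q) (map.toFun p)

instance : Category (GRep.{w} F H 𝒢) where
  Hom := Hom
  id A := ⟨𝟙 A.P, fun _ _ _ h => h⟩
  comp f g := ⟨f.map ≫ g.map, fun a q p h => g.intertwines a _ _ (f.intertwines a q p h)⟩

/-- The functor that remembers only the principal bundle. -/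
def forget : GRep.{w} F H 𝒢 ⥤ PrincipalBundle.{w} E X F H where
  obj A := A.P
  map f := f.map

/-- The map of total spaces underlying an automorphism of a representation. -/
def autFun {A : GRep.{w} F H 𝒢} (u : Aut A) : A.P.carrier → A.P.carrier :=
  u.hom.map.toFun

end GRep

/-! ### The category of Jordan–Chevalley triples -/

variable {k : ℕ} [MulAction (Fin k → ℂˣ) X]

/-- The monodromy `M_n(x) = φ(i(2πi n, x))`, in the isotropy of the Atiyah groupoid at `x`. -/
def monodromy (𝒢 : HomogeneousGroupoid E EG X G k) {P : PrincipalBundle.{w} E X F H}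
    (φ : RepOn 𝒢.toHolLieGroupoid P) (n : Fin k → ℤ) (x : X) : P.Atiyah :=
  φ.toFun (𝒢.i (lattice n, x))

/-- The gauge transformation `M_n` is semisimple at every point, for every `n`. In the frame `p`
the element `[p·m, p]` of the gauge groupoid is `m ∈ H`. -/
def HasSemisimpleMonodromy (𝒢 : HomogeneousGroupoid E EG X G k) (R : ReductiveGroup F H)
    {P : PrincipalBundle.{w} E X F H} (φ : RepOn 𝒢.toHolLieGroupoid P) : Prop :=
  ∀ (n : Fin k → ℤ) (p : P.carrier) (m : H),
    monodromy 𝒢 φ n (P.proj p) = P.arrow (P.act p m) p → R.IsSemisimple m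

/-- A unipotent automorphism of a representation. -/
def IsUnipotentAut {𝒢 : HolLieGroupoid E EG X G} (R : ReductiveGroup F H)
    {A : GRep.{w} F H 𝒢} (u : Aut A) : Prop :=
  ∀ (p : A.P.carrier) (h : H), GRep.autFun u p = A.P.act p h → R.IsUnipotent h

/-- Objects `(P, φ_s, U)` of the category `JC_H`. -/
structure JC (𝒢 : HomogeneousGroupoid E EG X G k) (R : ReductiveGroup F H) where
  /-- the representation `(P, φ_s)` -/
  rep : GRep.{w} F H 𝒢.toHolLieGroupoid
  semisimple : HasSemisimpleMonodromy 𝒢 R rep.φ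
  /-- the homomorphism `U : ℤ^k → Aut(φ_s)` -/
  U : Multiplicative (Fin k → ℤ) →* Aut rep
  unipotent : ∀ n, IsUnipotentAut R (U n)

namespace JC

variable {𝒢 : HomogeneousGroupoid E EG X G k} {R : ReductiveGroup F H}

/-- Morphisms of `JC_H`: bundle maps intertwining the representations and the unipotent
automorphisms. -/
@[ext]
structure Hom (A B : JC.{w} 𝒢 R) where
  /-- underlying morphism of representations -/
  map : A.rep ⟶ B.rep
  intertwines : ∀ n, (A.U n).hom ≫ map = map ≫ (B.U n).hom

instance : Category (JC.{w} 𝒢 R) where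
  Hom := Hom
  id A := ⟨𝟙 A.rep, fun n => by simp⟩
  comp f g := ⟨f.map ≫ g.map, fun n => by
    rw [← Category.assoc, f.intertwines, Category.assoc, g.intertwines, Category.assoc]⟩

/-- The functor that remembers only the principal bundle. -/
def forget : JC.{w} 𝒢 R ⥤ PrincipalBundle.{w} E X F H where
  obj A := A.rep.P
  map f := f.map.map

end JC

/-- `σ` is the section `σ_V(g) = exp (-1/(2πi) ∑ⱼ π(g)ⱼ log V_{eⱼ}(t(g)))` attached to a family
`V` of unipotent gauge transformations indexed by `ℤ^k`.  It is read in frames: if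
`V_{eⱼ}(q) = q·uⱼ` then `σ_V(g) = [q·c, q]` with `c = exp (-1/(2πi) ∑ⱼ π(g)ⱼ log uⱼ)`. -/
def IsUnipotentSection (𝒢 : HomogeneousGroupoid E EG X G k) (R : ReductiveGroup F H)
    (P : PrincipalBundle.{w} E X F H) (V : (Fin k → ℤ) → P.carrier → P.carrier)
    (σ : G → P.Atiyah) : Prop :=
  ∀ (g : G) (q : P.carrier), P.proj q = 𝒢.tgt g →
    ∃ (u : Fin k → H) (c : H), (∀ j, V (Pi.single j 1) q = P.act q (u j)) ∧
      R.IsExpLog (𝒢.π g) u c ∧ σ g = P.arrow (P.act q c) q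

/-- `ψ = σ_V φ`, where `σ_V` is a 1-cocycle valued in `φ`. -/
def IsTwist (𝒢 : HomogeneousGroupoid E EG X G k) (R : ReductiveGroup F H)
    {P : PrincipalBundle.{w} E X F H} (V : (Fin k → ℤ) → P.carrier → P.carrier)
    (φ ψ : RepOn 𝒢.toHolLieGroupoid P) : Prop :=
  ∃ σ : G → P.Atiyah, IsOneCocycle φ σ ∧ IsUnipotentSection 𝒢 R P V σ ∧
    ∀ g, (σ g).IsComp (φ.toFun g) (ψ.toFun g)

end Bundles

end JCDec

end

open JCDec

/-! In a frame `p` the monodromy is an element m_n(p) of H, conjugated by a change of frame. Since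
the lattice is central in the groupoid, m_n takes the same value at both ends of every arrow [q, p]
= φ(g) (`RepOn.frameMonodromy_invariant`). Its unipotent component u_n inherits equivariance and
invariance, and it is multiplicative in n because the m_n commute. As π is additive, exp(-1/(2πi) Σ
π(g)_j log u_{e_j}) is therefore a cocycle. On the arrow i(2πi n, x) it equals u_n⁻¹, so twisting by
it strips the unipotent component off the monodromy. The twist leaves U invariant, and twisting by
U⁻¹ restores φ; uniqueness of the Jordan decomposition makes the two constructions inverse to each
other. Both are natural for bundle maps, since these preserve frame values.

Two points need work. The components must lie in H: a Zariski closed set that contains all powers of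
s u contains s^a exp(b log u) for all natural a and complex b (`IsZariskiClosed.pow_mul_exp_mem`),
because an exponential polynomial in (n, t) that vanishes whenever t = n is zero. And U must be
holomorphic, although Jordan components are not even continuous in general: the characteristic
polynomial of m_n is continuous and constant on orbits, hence constant on X, which is a single
s-equivalence class (`RepOn.charpoly_frameMonodromy_eq`). One fixed polynomial then computes the
semisimple component in every frame (`exists_semisimplePart_polynomial`). -/

noncomputable section

namespace JCDec

/-! ### Exponentials and logarithms of nilpotent and unipotent elements -/

section BanachAlgebra

variable {𝔸 : Type*} [NormedRing 𝔸] [NormedAlgebra ℂ 𝔸] [CompleteSpace 𝔸]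

/-- Commutation gives exp(L s) = exp(L t) exp(L s - L t), so only the derivative of exp at 0 is
needed. -/
theorem hasDerivAt_exp_of_commute {L : ℂ → 𝔸} {L' : 𝔸} {t : ℂ} (hL : HasDerivAt L L' t)
    (hc : ∀ s, Commute (L t) (L s)) :
    HasDerivAt (fun s => NormedSpace.exp (L s)) (NormedSpace.exp (L t) * L') t := by
  let _ : NormedAlgebra ℚ 𝔸 := NormedAlgebra.restrictScalars ℚ ℂ 𝔸
  have h0 : HasFDerivAt (NormedSpace.exp : 𝔸 → 𝔸) (1 : 𝔸 →L[ℂ] 𝔸) (L t - L t) := by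
    rw [sub_self]; exact hasFDerivAt_exp_zero
  have h1 : HasDerivAt (fun s => NormedSpace.exp (L s - L t)) L' t := by
    exact h0.comp_hasDerivAt t (hL.sub_const (L t))
  have h2 := h1.const_mul (NormedSpace.exp (L t))
  refine h2.congr_of_eventuallyEq (Filter.Eventually.of_forall fun s => ?_)
  have : Commute (L t) (L s - L t) := (hc s).sub_right (Commute.refl _)
  simp only
  rw [← NormedSpace.exp_add_of_commute this, add_sub_cancel]

/-- With L(t) the truncated series of log(1 + t x), the function exp(-L(t)) (1 + t x) has zero
derivative, so its values at 0 and 1 agree. -/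
theorem exp_log_one_add {x : 𝔸} {N : ℕ} (hx : x ^ (N + 1) = 0) :
    NormedSpace.exp (∑ m ∈ Finset.range N, ((-1 : ℂ) ^ m / ((m : ℂ) + 1)) • x ^ (m + 1)) =
      1 + x := by
  let _ : NormedAlgebra ℚ 𝔸 := NormedAlgebra.restrictScalars ℚ ℂ 𝔸
  set L : ℂ → 𝔸 := fun t => ∑ m ∈ Finset.range N,
    (t ^ (m + 1) * ((-1 : ℂ) ^ m / ((m : ℂ) + 1))) • x ^ (m + 1) with hLdef
  have hcomm : ∀ s, Commute (L s) x := fun s =>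
    Commute.sum_left _ _ _ fun m _ => ((Commute.refl x).pow_left _).smul_left _
  have hLL : ∀ s t, Commute (L s) (L t) := fun s t =>
    Commute.sum_right _ _ _ fun m _ => ((hcomm s).pow_right _).smul_right _
  have hL : ∀ t, HasDerivAt L (∑ m ∈ Finset.range N, ((-t) ^ m) • x ^ (m + 1)) t := by
    intro t
    refine HasDerivAt.fun_sum fun m _ => ?_
    have h := ((hasDerivAt_pow (m + 1) t).mul_const ((-1 : ℂ) ^ m / ((m : ℂ) + 1))).smul_const
      (x ^ (m + 1))
    convert h using 2
    have : (m : ℂ) + 1 ≠ 0 := by exact_mod_cast Nat.succ_ne_zero m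
    rw [neg_pow]
    push_cast
    field_simp
  -- L'(t) is a truncated geometric series for x (1 + t x)⁻¹; the remainder carries x^(N+1) = 0.
  have hgeom : ∀ t : ℂ, (∑ m ∈ Finset.range N, ((-t) ^ m) • x ^ (m + 1)) * (1 + t • x) = x := by
    intro t
    have e1 : (∑ m ∈ Finset.range N, ((-t) ^ m) • x ^ (m + 1))
        = x * ∑ m ∈ Finset.range N, ((-t) • x) ^ m := by
      rw [Finset.mul_sum]
      refine Finset.sum_congr rfl fun m _ => ?_
      rw [smul_pow, pow_succ', mul_smul_comm]
    have e2 : (1 + t • x) = 1 - (-t) • x := by simp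
    rw [e1, e2, mul_assoc, geom_sum_mul_neg, mul_sub, mul_one, smul_pow, mul_smul_comm, ← pow_succ',
      hx]
    simp
  set f : ℂ → 𝔸 := fun t => NormedSpace.exp (-L t) * (1 + t • x) with hf
  have hfd : ∀ t, HasDerivAt f 0 t := by
    intro t
    have h1 := hasDerivAt_exp_of_commute (hL t).neg
      (fun s => ((hLL t s).neg_left).neg_right)
    have h2 : HasDerivAt (fun t : ℂ => 1 + t • x) x t := by
      simpa using ((hasDerivAt_id t).smul_const x).const_add (1 : 𝔸)
    have h3 := h1.mul h2
    rw [mul_assoc, neg_mul, hgeom, mul_neg, neg_add_cancel] at h3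
    exact h3
  have hconst := is_const_of_deriv_eq_zero (fun t => (hfd t).differentiableAt)
    (fun t => (hfd t).deriv) 1 0
  have h0 : f 0 = 1 := by simp [hf, hLdef]
  have h1 : f 1 = NormedSpace.exp (-L 1) * (1 + x) := by simp [hf]
  rw [h0, h1] at hconst
  have h4 : NormedSpace.exp (L 1) * NormedSpace.exp (-L 1) = 1 := by
    rw [← NormedSpace.exp_add_of_commute (Commute.refl _).neg_right, add_neg_cancel,
      NormedSpace.exp_zero]
  have h5 : NormedSpace.exp (L 1) = 1 + x := by
    have h6 := congrArg (NormedSpace.exp (L 1) * ·) hconst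
    simp only [← mul_assoc, h4, one_mul, mul_one] at h6
    exact h6.symm
  simpa [hLdef] using h5

end BanachAlgebra

section Matrices

variable {N : ℕ}

/-- The Taylor polynomial of the logarithm of a unipotent matrix. -/
def unipotentLog (A : Matrix (Fin N) (Fin N) ℂ) : Matrix (Fin N) (Fin N) ℂ :=
  ∑ m ∈ Finset.range N, ((-1 : ℂ) ^ m / ((m : ℂ) + 1)) • (A - 1) ^ (m + 1)

theorem pow_eq_zero_of_isNilpotent {A : Matrix (Fin N) (Fin N) ℂ} (hA : IsNilpotent A) :
    A ^ N = 0 := by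
  have h := Matrix.isNilpotent_charpoly_sub_pow_of_isNilpotent hA
  have h' : A.charpoly = Polynomial.X ^ N := by
    simpa using sub_eq_zero.mp h.eq_zero
  simpa [h'] using Matrix.aeval_self_charpoly A

/-- The truncation length depends on the matrix size alone, so exp is one fixed polynomial map on
all nilpotent matrices; holomorphy of exponentials rests on this. -/
theorem exp_eq_sum_of_isNilpotent {A : Matrix (Fin N) (Fin N) ℂ} (hA : IsNilpotent A) :
    NormedSpace.exp A = ∑ m ∈ Finset.range N, ((m.factorial : ℂ))⁻¹ • A ^ m := by
  rw [NormedSpace.exp_eq_tsum ℂ]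
  refine tsum_eq_sum fun m hm => ?_
  rw [pow_eq_zero_of_le (by simpa using hm) (pow_eq_zero_of_isNilpotent hA), smul_zero]

theorem exp_add_of_commute {A B : Matrix (Fin N) (Fin N) ℂ} (h : Commute A B) :
    NormedSpace.exp (A + B) = NormedSpace.exp A * NormedSpace.exp B :=
  Matrix.exp_add_of_commute A B h

theorem exp_unipotentLog {A : Matrix (Fin N) (Fin N) ℂ} (hA : IsUnipotentMatrix A) :
    NormedSpace.exp (unipotentLog A) = A := by
  let _ : NormedRing (Matrix (Fin N) (Fin N) ℂ) := Matrix.linftyOpNormedRing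
  let _ : NormedAlgebra ℂ (Matrix (Fin N) (Fin N) ℂ) := Matrix.linftyOpNormedAlgebra
  have h : (A - 1) ^ (N + 1) = 0 :=
    pow_eq_zero_of_le (Nat.le_succ N) (pow_eq_zero_of_isNilpotent hA)
  have := exp_log_one_add h
  rw [add_sub_cancel] at this
  exact this

theorem commute_unipotentLog_right {A B : Matrix (Fin N) (Fin N) ℂ} (h : Commute B A) :
    Commute B (unipotentLog A) :=
  Commute.sum_right _ _ _ fun _ _ =>
    ((h.sub_right (Commute.one_right _)).pow_right _).smul_right _

theorem commute_unipotentLog {A B : Matrix (Fin N) (Fin N) ℂ} (h : Commute A B) :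
    Commute (unipotentLog A) (unipotentLog B) :=
  commute_unipotentLog_right (commute_unipotentLog_right h.symm).symm

theorem isNilpotent_sum_of_commute {R ι : Type*} [Ring R] (s : Finset ι) (f : ι → R)
    (hf : ∀ i ∈ s, IsNilpotent (f i)) (hc : ∀ i j, Commute (f i) (f j)) :
    IsNilpotent (∑ i ∈ s, f i) := by
  classical
  induction s using Finset.induction_on with
  | empty => simp
  | insert a s ha ih =>
    rw [Finset.sum_insert ha]
    exact Commute.isNilpotent_add (Commute.sum_right _ _ _ fun i _ => hc a i)
      (hf a (by simp)) (ih fun i hi => hf i (by simp [hi]))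

theorem isNilpotent_unipotentLog {A : Matrix (Fin N) (Fin N) ℂ} (hA : IsUnipotentMatrix A) :
    IsNilpotent (unipotentLog A) := by
  refine isNilpotent_sum_of_commute _ _ (fun m _ => ?_) fun i j => ?_
  · exact IsNilpotent.smul (hA.pow_of_pos (Nat.succ_ne_zero m)) _
  · exact (((Commute.refl (A - 1)).pow_pow _ _).smul_left _).smul_right _

theorem unipotentLog_conj {g g' : Matrix (Fin N) (Fin N) ℂ} (hg : g * g' = 1)
    (A : Matrix (Fin N) (Fin N) ℂ) :
    unipotentLog (g * A * g') = g * unipotentLog A * g' := by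
  have hg' : g' * g = 1 := mul_eq_one_comm.mp hg
  have e : g * A * g' - 1 = g * (A - 1) * g' := by
    rw [mul_sub, sub_mul, mul_one, hg]
  have h : ∀ m : ℕ, (g * A * g' - 1) ^ m = g * (A - 1) ^ m * g' := by
    intro m
    rw [e]
    induction m with
    | zero => simp [hg]
    | succ m ih =>
      rw [pow_succ, ih, pow_succ]
      simp only [mul_assoc]
      rw [← mul_assoc g' g, hg', one_mul]
  simp only [unipotentLog, h, Finset.mul_sum, Finset.sum_mul, mul_smul_comm, smul_mul_assoc]

/-- exp A - 1 factors as A B, where B is 1 plus a nilpotent matrix and hence a unit. -/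
theorem eq_zero_of_exp_eq_one {A : Matrix (Fin N) (Fin N) ℂ} (hA : IsNilpotent A)
    (h : NormedSpace.exp A = 1) : A = 0 := by
  rcases N with _ | N
  · ext i; exact i.elim0
  rw [exp_eq_sum_of_isNilpotent hA, Finset.sum_range_succ'] at h
  simp only [Nat.factorial_zero, Nat.cast_one, inv_one, pow_zero, one_smul, add_eq_right] at h
  set B : Matrix (Fin (N + 1)) (Fin (N + 1)) ℂ :=
    ∑ m ∈ Finset.range N, (((m + 1).factorial : ℂ))⁻¹ • A ^ m
  have hAB : A * B = 0 := by
    rw [← h, Finset.mul_sum]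
    exact Finset.sum_congr rfl fun m _ => by rw [mul_smul_comm, pow_succ']
  -- In size 1 the sum B is empty rather than a unit, but there A = A^1 = 0 already.
  rcases N with _ | N
  · simpa using pow_eq_zero_of_isNilpotent hA
  have hB : B = 1 + ∑ m ∈ Finset.range N, (((m + 2).factorial : ℂ))⁻¹ • A ^ (m + 1) := by
    simp only [B]
    rw [Finset.sum_range_succ']
    simp [add_comm (1 : Matrix (Fin (N + 1 + 1)) (Fin (N + 1 + 1)) ℂ)]
  have hu : IsUnit B := by
    rw [hB]
    refine IsNilpotent.isUnit_one_add (isNilpotent_sum_of_commute _ _ (fun m _ => ?_) fun i j => ?_)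
    · exact IsNilpotent.smul (hA.pow_of_pos (Nat.succ_ne_zero m)) _
    · exact (((Commute.refl A).pow_pow _ _).smul_left _).smul_right _
  exact hu.mul_left_eq_zero.mp hAB

theorem IsUnipotentMatrix.mul {A B : Matrix (Fin N) (Fin N) ℂ} (hA : IsUnipotentMatrix A)
    (hB : IsUnipotentMatrix B) (h : Commute A B) : IsUnipotentMatrix (A * B) := by
  have e : A * B - 1 = (A - 1) * B + (B - 1) := by noncomm_ring
  unfold IsUnipotentMatrix
  rw [e]
  have h1 : Commute (A - 1) B := h.sub_left (Commute.one_left _)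
  refine Commute.isNilpotent_add ?_ (h1.isNilpotent_mul_right hA) hB
  exact (h1.sub_right (Commute.one_right _)).mul_left
    ((Commute.refl B).sub_right (Commute.one_right _))

theorem IsUnipotentMatrix.of_mul_eq_one {A B : Matrix (Fin N) (Fin N) ℂ}
    (hA : IsUnipotentMatrix A) (h : A * B = 1) : IsUnipotentMatrix B := by
  have h' : B * A = 1 := mul_eq_one_comm.mp h
  have e : B - 1 = -((A - 1) * B) := by rw [sub_mul, h]; noncomm_ring
  have hc : Commute (A - 1) B := by
    rw [Commute, SemiconjBy, sub_mul, mul_sub, h, h']; simp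
  unfold IsUnipotentMatrix
  rw [e]
  exact (hc.isNilpotent_mul_right hA).neg

/-- The two logarithms commute, and their sum is nilpotent with exponential 1, hence zero. -/
theorem unipotentLog_of_mul_eq_one {A B : Matrix (Fin N) (Fin N) ℂ} (hA : IsUnipotentMatrix A)
    (h : A * B = 1) : unipotentLog B = -unipotentLog A := by
  have hB := hA.of_mul_eq_one h
  have hc : Commute A B := by rw [Commute, SemiconjBy, h, mul_eq_one_comm.mp h]
  have hl := commute_unipotentLog hc
  have : unipotentLog A + unipotentLog B = 0 := by
    refine eq_zero_of_exp_eq_one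
      (hl.isNilpotent_add (isNilpotent_unipotentLog hA) (isNilpotent_unipotentLog hB)) ?_
    rw [exp_add_of_commute hl, exp_unipotentLog hA, exp_unipotentLog hB, h]
  exact (neg_eq_of_add_eq_zero_right this).symm

theorem commute_exp_right {A B : Matrix (Fin N) (Fin N) ℂ} (hB : IsNilpotent B)
    (h : Commute A B) : Commute A (NormedSpace.exp B) := by
  rw [exp_eq_sum_of_isNilpotent hB]
  exact Commute.sum_right _ _ _ fun m _ => (h.pow_right _).smul_right _

end Matrices

/-! ### The Jordan–Chevalley decomposition of matrices -/

section JordanChevalley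

open Polynomial

/-- The semisimple part of a matrix is given by a polynomial that depends only on an annihilating
polynomial of the matrix. -/
theorem exists_semisimplePart_polynomial (N : ℕ) {χ : ℂ[X]} (hχ : χ ≠ 0) :
    ∃ q : ℂ[X], ∀ A : Matrix (Fin N) (Fin N) ℂ, aeval A χ = 0 →
      Module.End.IsSemisimple (Matrix.toLin' (aeval A q)) ∧ IsNilpotent (A - aeval A q) := by
  obtain ⟨P, k, sep, -, nil⟩ := exists_squarefree_dvd_pow_of_ne_zero hχ
  have hsq := sep
  rw [← PerfectField.separable_iff_squarefree] at sep
  have hnil : IsNilpotent (aeval (AdjoinRoot.root χ) P) := by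
    refine ⟨k, ?_⟩
    rw [← map_pow, AdjoinRoot.aeval_eq, AdjoinRoot.mk_eq_zero]
    exact nil
  have hunit : IsUnit (aeval (AdjoinRoot.root χ) (derivative P)) := by
    obtain ⟨a, b, hab⟩ := sep
    have h1 := congrArg (aeval (AdjoinRoot.root χ)) hab
    simp only [map_add, map_mul, map_one] at h1
    have h2 : IsUnit (aeval (AdjoinRoot.root χ) b * aeval (AdjoinRoot.root χ) (derivative P)) := by
      rw [← eq_sub_iff_add_eq'] at h1
      rw [h1]
      exact ((Commute.all _ _).isNilpotent_mul_left hnil).isUnit_one_sub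
    exact isUnit_of_mul_isUnit_right h2
  -- Newton iteration is run on the universal root in ℂ[X]/(χ), where the squarefree P is nilpotent
  -- and P' is a unit. A lift q of the resulting root of P then serves every matrix killed by χ.
  obtain ⟨r, ⟨⟨j, hr1⟩, hr2⟩, -⟩ := existsUnique_nilpotent_sub_and_aeval_eq_zero hnil hunit
  obtain ⟨q, rfl⟩ := AdjoinRoot.mk_surjective r
  refine ⟨q, fun A hA => ⟨?_, j, ?_⟩⟩
  · have hd : χ ∣ P.comp q := by
      rw [← AdjoinRoot.mk_eq_zero, ← hr2, ← AdjoinRoot.aeval_eq, aeval_comp, AdjoinRoot.aeval_eq]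
    obtain ⟨c, hc⟩ := hd
    have h0 : aeval (aeval A q) P = 0 := by
      rw [← aeval_comp, hc, map_mul, hA, zero_mul]
    refine Module.End.isSemisimple_of_squarefree_aeval_eq_zero hsq ?_
    have := aeval_algHom_apply (Matrix.toLinAlgEquiv' (R := ℂ) (n := Fin N)) (aeval A q) P
    rw [h0, map_zero] at this
    exact this
  · have hd : χ ∣ (X - q) ^ j := by
      rw [← AdjoinRoot.mk_eq_zero, ← hr1, map_pow, map_sub, AdjoinRoot.mk_X]
    obtain ⟨c, hc⟩ := hd
    have := congrArg (aeval A) hc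
    rw [map_mul, hA, zero_mul] at this
    simpa using this

variable {N : ℕ}

/-- Writing s u = s + s (u - 1) reduces the claim to uniqueness of the additive decomposition;
cancelling the unit s recovers u. -/
theorem jordanChevalley_unique {s u s' u' : Matrix (Fin N) (Fin N) ℂ}
    (hs : Module.End.IsSemisimple (Matrix.toLin' s)) (hs' : Module.End.IsSemisimple (Matrix.toLin' s'))
    (hu : IsUnipotentMatrix u) (hu' : IsUnipotentMatrix u') (hc : Commute s u)
    (hc' : Commute s' u') (hunit : IsUnit s) (h : s * u = s' * u') : s = s' ∧ u = u' := by
  have key : ∀ {s u : Matrix (Fin N) (Fin N) ℂ}, IsUnipotentMatrix u → Commute s u →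
      IsNilpotent (Matrix.toLin' (s * (u - 1))) ∧
      Commute (Matrix.toLin' (s * (u - 1))) (Matrix.toLin' s) := by
    intro s u hu hc
    have h1 : Commute s (u - 1) := hc.sub_right (Commute.one_right _)
    refine ⟨(Matrix.isNilpotent_toLin'_iff _).mpr (h1.isNilpotent_mul_left hu), ?_⟩
    exact ((Commute.refl s).mul_left h1.symm).map (Matrix.toLinAlgEquiv' (R := ℂ) (n := Fin N))
  have h2 : Matrix.toLin' (s * (u - 1)) + Matrix.toLin' s =
      Matrix.toLin' (s' * (u' - 1)) + Matrix.toLin' s' := by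
    rw [← map_add, ← map_add, mul_sub, mul_sub, mul_one, mul_one, sub_add_cancel, sub_add_cancel, h]
  have h3 := Module.End.isNilpotent_isSemisimple_unique (key hu hc).1 hs (key hu' hc').1 hs'
    (key hu hc).2 (key hu' hc').2 h2
  have h4 : s = s' := Matrix.toLin'.injective h3.2
  exact ⟨h4, hunit.mul_left_cancel (by rw [h, h4])⟩

end JordanChevalley

/-! ### Exponential polynomials -/

section ExponentialPolynomials

open Polynomial

/-- The functions `n ↦ μ ^ n q`, for a fixed number `μ` and arbitrary polynomials `q`. -/
def expPolySpace (μ : ℂ) : ℂ[X] →ₗ[ℂ] (ℕ → ℂ[X]) where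
  toFun q n := μ ^ n • q
  map_add' q q' := by ext; simp
  map_smul' c q := by ext; simp [mul_left_comm]

/-- Evaluation of the polynomial `F n` at `n`. -/
def diagEval : (ℕ → ℂ[X]) →ₗ[ℂ] (ℕ → ℂ) where
  toFun F n := (F n).eval (n : ℂ)
  map_add' F F' := by ext; simp
  map_smul' c F := by ext; simp

/-- The shift operator on sequences. -/
def shift : Module.End ℂ (ℕ → ℂ) where
  toFun f n := f (n + 1)
  map_add' F F' := by ext; simp
  map_smul' c F := by ext; simp

/-- The operator shift - μ sends n ↦ μ^n q(n) to μ^(n+1) times the forward difference of q, and deg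
q + 1 differences annihilate q. -/
theorem diagEval_mem_maxGenEigenspace (μ : ℂ) (q : ℂ[X]) :
    diagEval (expPolySpace μ q) ∈ shift.maxGenEigenspace μ := by
  have h : ∀ (k : ℕ), ((shift - algebraMap ℂ _ μ) ^ k) (diagEval (expPolySpace μ q)) =
      fun n => μ ^ (n + k) * ((fwdDiff (1 : ℂ))^[k] q.eval) n := by
    intro k
    induction k with
    | zero => ext n; simp [diagEval, expPolySpace]
    | succ k ih =>
      rw [pow_succ', Module.End.mul_apply, ih]
      ext n
      rw [Function.iterate_succ_apply']
      simp [shift, fwdDiff, Module.algebraMap_end_apply]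
      ring
  rw [Module.End.mem_maxGenEigenspace]
  refine ⟨q.natDegree + 1, ?_⟩
  have h' := h (q.natDegree + 1)
  rw [Polynomial.fwdDiff_iter_degree_add_one_eq_zero] at h'
  rw [← Algebra.algebraMap_eq_smul_one, h']
  ext; simp

theorem expPolySpace_eq_zero_of_diagEval {μ : ℂ} (hμ : μ ≠ 0) {q : ℂ[X]}
    (h : diagEval (expPolySpace μ q) = 0) : q = 0 := by
  refine Polynomial.eq_zero_of_infinite_isRoot q ?_
  refine (Set.infinite_range_of_injective (Nat.cast_injective (R := ℂ))).mono ?_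
  rintro _ ⟨n, rfl⟩
  have := congrFun h n
  simpa [diagEval, expPolySpace, hμ] using this

/-- The algebra generated by the exponentials `n ↦ μ ^ n` (with `μ ≠ 0`) and the polynomials. -/
def expPolyAlgebra : Subalgebra ℂ (ℕ → ℂ[X]) :=
  Algebra.adjoin ℂ {F | ∃ μ : ℂ, μ ≠ 0 ∧ ∃ q, F = expPolySpace μ q}

/-- The generators are closed under products, (μ, q)(μ', q') = (μ μ', q q'), so the algebra they
generate is their linear span. -/
theorem expPolyAlgebra_le_iSup :
    Subalgebra.toSubmodule expPolyAlgebra ≤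
      ⨆ μ : {μ : ℂ // μ ≠ 0}, LinearMap.range (expPolySpace μ) := by
  rw [expPolyAlgebra, Algebra.adjoin_eq_span, Submodule.span_le]
  intro F hF
  have : ∃ μ : ℂ, μ ≠ 0 ∧ ∃ q, F = expPolySpace μ q := by
    induction hF using Submonoid.closure_induction with
    | mem F h => exact h
    | one => exact ⟨1, one_ne_zero, 1, by ext; simp [expPolySpace]⟩
    | mul F F' _ _ h h' =>
      obtain ⟨μ, hμ, q, rfl⟩ := h
      obtain ⟨μ', hμ', q', rfl⟩ := h'
      refine ⟨μ * μ', mul_ne_zero hμ hμ', q * q', ?_⟩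
      funext n
      simp only [expPolySpace, LinearMap.coe_mk, AddHom.coe_mk, Pi.mul_apply, mul_pow]
      rw [smul_mul_smul_comm]
  obtain ⟨μ, hμ, q, rfl⟩ := this
  exact Submodule.mem_iSup_of_mem (⟨μ, hμ⟩ : {μ : ℂ // μ ≠ 0}) ⟨q, rfl⟩

/-- Generalized eigenspaces of the shift for distinct μ are independent, so each summand vanishes on
the diagonal separately, and its polynomial has every natural number as a root. This frees the
polynomial variable from the exponent n. -/
theorem eq_zero_of_diagEval_eq_zero {F : ℕ → ℂ[X]} (hF : F ∈ expPolyAlgebra)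
    (h : diagEval F = 0) : F = 0 := by
  have hF' := expPolyAlgebra_le_iSup hF
  rw [Submodule.mem_iSup_iff_exists_finsupp] at hF'
  obtain ⟨f, hf, rfl⟩ := hF'
  have hind : iSupIndep fun μ : {μ : ℂ // μ ≠ 0} => shift.maxGenEigenspace μ.1 :=
    (Module.End.independent_maxGenEigenspace shift).comp Subtype.val_injective
  have hmem : ∀ μ, diagEval (f μ) ∈ shift.maxGenEigenspace μ.1 := by
    intro μ
    obtain ⟨q, hq⟩ := hf μ
    rw [← hq]
    exact diagEval_mem_maxGenEigenspace _ _
  rw [Finsupp.sum, map_sum] at h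
  have hz : ∀ μ ∈ f.support, diagEval (f μ) = 0 := by
    classical
    intro μ hμ
    refine Submodule.disjoint_def.mp (hind μ) _ (hmem μ) ?_
    rw [← Finset.add_sum_erase _ _ hμ] at h
    rw [eq_neg_of_add_eq_zero_left h]
    refine Submodule.neg_mem _ (Submodule.sum_mem _ fun ν hν => ?_)
    exact Submodule.mem_iSup_of_mem ν
      (Submodule.mem_iSup_of_mem (Finset.ne_of_mem_erase hν) (hmem ν))
  refine Finset.sum_eq_zero fun μ hμ => ?_
  obtain ⟨q, hq⟩ := hf μ
  have := hz μ hμ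
  rw [← hq] at this ⊢
  rw [expPolySpace_eq_zero_of_diagEval μ.2 this, map_zero]

end ExponentialPolynomials

/-! ### Zariski closed matrix groups contain Jordan components and unipotent one-parameter groups -/

section Zariski

open Polynomial

variable {N : ℕ}

theorem commute_aeval {A B : Matrix (Fin N) (Fin N) ℂ} (h : Commute B A) (q : ℂ[X]) :
    Commute B (aeval A q) := by
  induction q using Polynomial.induction_on' with
  | add p q hp hq => simpa using hp.add_right hq
  | monomial n a =>
    rw [aeval_monomial]
    exact Commute.mul_right (Algebra.commutes a B).symm (h.pow_right n)

theorem aeval_conj {g g' : Matrix (Fin N) (Fin N) ℂ} (hg : g * g' = 1)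
    (A : Matrix (Fin N) (Fin N) ℂ) (q : ℂ[X]) :
    aeval (g * A * g') q = g * aeval A q * g' := by
  have hg' : g' * g = 1 := mul_eq_one_comm.mp hg
  have h : ∀ m : ℕ, (g * A * g') ^ m = g * A ^ m * g' := by
    intro m
    induction m with
    | zero => simp [hg]
    | succ m ih =>
      rw [pow_succ, ih, pow_succ]
      simp only [mul_assoc]
      rw [← mul_assoc g' g, hg', one_mul]
  simp only [aeval_eq_sum_range, h, Finset.mul_sum, Finset.sum_mul, mul_smul_comm,
    smul_mul_assoc]

theorem const_mem_expPolyAlgebra (q : ℂ[X]) : (fun _ => q) ∈ expPolyAlgebra :=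
  Algebra.subset_adjoin ⟨1, one_ne_zero, q, by ext; simp [expPolySpace]⟩

/-- The entries of the powers of an invertible semisimple matrix are sums of exponentials. -/
theorem pow_entry_mem_expPolyAlgebra {s : Matrix (Fin N) (Fin N) ℂ}
    (hs : Module.End.IsSemisimple (Matrix.toLin' s)) (hunit : IsUnit s) (i j : Fin N) :
    (fun n => C ((s ^ n) i j)) ∈ expPolyAlgebra := by
  have key : ∀ v : Fin N → ℂ, (fun n => C ((Matrix.toLin' (s ^ n) v) i)) ∈ expPolyAlgebra := by
    intro v
    have hv : v ∈ ⨆ μ, Module.End.maxGenEigenspace (Matrix.toLin' s) μ := by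
      rw [Module.End.iSup_maxGenEigenspace_eq_top]; trivial
    induction hv using Submodule.iSup_induction' with
    | mem μ v hv =>
      rw [hs.isFinitelySemisimple.maxGenEigenspace_eq_eigenspace, Module.End.mem_eigenspace_iff] at hv
      have hpow : ∀ n : ℕ, Matrix.toLin' (s ^ n) v = μ ^ n • v := by
        intro n
        induction n with
        | zero => simp
        | succ n ih =>
          rw [pow_succ, Matrix.toLin'_mul, LinearMap.comp_apply, hv, map_smul, ih, smul_smul,
            pow_succ']
      -- The algebra only admits μ ≠ 0; invertibility of s rules out nonzero eigenvectors for 0.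
      by_cases hμ : μ = 0
      · have hv0 : v = 0 := by
          subst hμ
          rw [zero_smul, Matrix.toLin'_apply] at hv
          obtain ⟨t, rfl⟩ := hunit
          have := congrArg (Matrix.mulVec (↑t⁻¹ : Matrix (Fin N) (Fin N) ℂ)) hv
          simpa using this
        subst hv0
        simp only [map_zero, Pi.zero_apply]; exact Subalgebra.zero_mem expPolyAlgebra
      · refine Algebra.subset_adjoin ⟨μ, hμ, C (v i), ?_⟩
        ext n : 1
        rw [hpow]
        simp [expPolySpace, smul_eq_C_mul]
    | zero => simp only [map_zero, Pi.zero_apply]; exact Subalgebra.zero_mem expPolyAlgebra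
    | add v v' _ _ h h' => simpa using! Subalgebra.add_mem _ h h'
  simpa only [Matrix.toLin'_apply, Matrix.mulVec_single_one, Matrix.col_apply] using
    key (Pi.single j 1)

theorem aeval_mem_subalgebra {σ A : Type*} [CommRing A] [Algebra ℂ A] (S : Subalgebra ℂ A)
    {x : σ → A} (hx : ∀ i, x i ∈ S) (f : MvPolynomial σ ℂ) : MvPolynomial.aeval x f ∈ S := by
  induction f using MvPolynomial.induction_on with
  | C a => simp
  | add p q hp hq => simpa using S.add_mem hp hq
  | mul_X p i hp => simpa using S.mul_mem hp (hx i)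

/-- If a Zariski closed set of matrices contains all the powers of `s u`, where `s` is semisimple
and `u` unipotent, then it contains all products `s ^ a u ^ b` for `b` complex. -/
theorem IsZariskiClosed.pow_mul_exp_mem {Z : Set (GL (Fin N) ℂ)} (hZ : IsZariskiClosed Z)
    {s u : Matrix (Fin N) (Fin N) ℂ} (hs : Module.End.IsSemisimple (Matrix.toLin' s))
    (hunit : IsUnit s) (hu : IsUnipotentMatrix u) (hc : Commute s u)
    (h : ∀ n : ℕ, ∃ g ∈ Z, (g : Matrix (Fin N) (Fin N) ℂ) = (s * u) ^ n) (a : ℕ) (b : ℂ) :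
    ∃ g ∈ Z, (g : Matrix (Fin N) (Fin N) ℂ) = s ^ a * NormedSpace.exp (b • unipotentLog u) := by
  obtain ⟨S, rfl⟩ := hZ
  have hnil := isNilpotent_unipotentLog hu
  obtain ⟨g, hg⟩ : IsUnit (s ^ a * NormedSpace.exp (b • unipotentLog u)) :=
    (hunit.pow a).mul (Matrix.isUnit_exp _)
  refine ⟨g, fun f hf => ?_, hg⟩
  -- The entries of exp(X log u), polynomials in X because log u is nilpotent.
  set e : Fin N → Fin N → ℂ[X] := fun i j => ∑ m ∈ Finset.range N,
    C ((m.factorial : ℂ)⁻¹ * ((unipotentLog u) ^ m) i j) * X ^ m with he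
  have heval : ∀ (c : ℂ) i j, (e i j).eval c = NormedSpace.exp (c • unipotentLog u) i j := by
    intro c i j
    rw [exp_eq_sum_of_isNilpotent (hnil.smul c), Matrix.sum_apply, he, eval_finsetSum]
    refine Finset.sum_congr rfl fun m _ => ?_
    simp [_root_.smul_pow]
    ring
  -- The entries of s^n exp(X log u), with n and X independent.
  set x : Fin N × Fin N → ℕ → ℂ[X] := fun p n => ∑ l, C ((s ^ n) p.1 l) * e l p.2 with hx
  have hxmem : ∀ p, x p ∈ expPolyAlgebra := by
    intro p
    have : x p = ∑ l, (fun n => C ((s ^ n) p.1 l)) * (fun _ => e l p.2) := by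
      ext n : 1; simp [hx]
    rw [this]
    exact Subalgebra.sum_mem _ fun l _ => Subalgebra.mul_mem _
      (pow_entry_mem_expPolyAlgebra hs hunit _ _) (const_mem_expPolyAlgebra _)
  have hF := aeval_mem_subalgebra expPolyAlgebra hxmem f
  have hFeval : ∀ (n : ℕ) (c : ℂ), ((MvPolynomial.aeval x f) n).eval c =
      MvPolynomial.eval (fun p : Fin N × Fin N =>
        (s ^ n * NormedSpace.exp (c • unipotentLog u)) p.1 p.2) f := by
    intro n c
    have h1 : (fun p : Fin N × Fin N => (s ^ n * NormedSpace.exp (c • unipotentLog u)) p.1 p.2)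
        = fun p => (x p n).eval c := by
      ext p
      simp [hx, Matrix.mul_apply, eval_finsetSum, heval]
    rw [h1]
    have h2 := MvPolynomial.map_aeval (R := ℂ) x
      ((evalRingHom c).comp (Pi.evalRingHom (fun _ : ℕ => ℂ[X]) n)) f
    simp only [RingHom.comp_apply, Pi.evalRingHom_apply, coe_evalRingHom] at h2
    rw [h2, MvPolynomial.eval, MvPolynomial.coe_eval₂Hom, MvPolynomial.coe_eval₂Hom]
    congr 1
    ext z
    simp
  -- At X = n the matrix is (s u)^n, where each defining equation f of the Zariski closed set
  -- vanishes.
  have hdiag : diagEval (MvPolynomial.aeval x f) = 0 := by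
    ext n
    change ((MvPolynomial.aeval x f) n).eval (n : ℂ) = 0
    obtain ⟨g', hg', hgn⟩ := h n
    have h3 : s ^ n * NormedSpace.exp ((n : ℂ) • unipotentLog u) = (s * u) ^ n := by
      rw [hc.mul_pow, Nat.cast_smul_eq_nsmul, Matrix.exp_nsmul, exp_unipotentLog hu]
    rw [hFeval, h3, ← hgn]
    exact hg' f hf
  have := hFeval a b
  rw [eq_zero_of_diagEval_eq_zero hF hdiag] at this
  rw [hg]
  simpa using this.symm

end Zariski

/-! ### Elements of a reductive group -/

namespace ReductiveGroup

variable {F H : Type*} [NormedAddCommGroup F] [NormedSpace ℂ F]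
  [TopologicalSpace H] [ChartedSpace F H] [Group H] (R : ReductiveGroup F H)

theorem log_eq (u : H) : R.log u = unipotentLog (R.mat u) := rfl

@[simp] theorem mat_mul (a b : H) : R.mat (a * b) = R.mat a * R.mat b := by simp [mat]

@[simp] theorem mat_one : R.mat (1 : H) = 1 := by simp [mat]

@[simp] theorem mat_pow (a : H) (n : ℕ) : R.mat (a ^ n) = R.mat a ^ n := by simp [mat]

theorem mat_mul_mat_inv (a : H) : R.mat a * R.mat a⁻¹ = 1 := by
  rw [← mat_mul, mul_inv_cancel, mat_one]

theorem mat_inv_mul_mat (a : H) : R.mat a⁻¹ * R.mat a = 1 := by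
  rw [← mat_mul, inv_mul_cancel, mat_one]

theorem isUnit_mat (a : H) : IsUnit (R.mat a) :=
  ⟨⟨_, _, R.mat_mul_mat_inv a, R.mat_inv_mul_mat a⟩, rfl⟩

theorem mat_injective : Function.Injective R.mat := fun _ _ h =>
  R.embedding.isEmbedding.injective h

theorem commute_mat {a b : H} (h : Commute a b) : Commute (R.mat a) (R.mat b) := by
  rw [Commute, SemiconjBy, ← mat_mul, ← mat_mul, h.eq]

theorem commute_of_mat {a b : H} (h : Commute (R.mat a) (R.mat b)) : Commute a b :=
  R.mat_injective (by simpa using h.eq)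

theorem exists_mat_eq_of_mem {A : Matrix (Fin R.N) (Fin R.N) ℂ}
    (h : ∃ g ∈ Set.range R.ρ, (g : Matrix (Fin R.N) (Fin R.N) ℂ) = A) : ∃ a : H, R.mat a = A := by
  obtain ⟨_, ⟨a, rfl⟩, ha⟩ := h
  exact ⟨a, ha⟩

/-- The choices (a, b) = (1, 0) and (0, 1) put the Jordan components in the group; s = 1 and a = 0
give the complex one-parameter group through a unipotent element. -/
theorem exists_mat_eq_pow_mul_exp (m : H) {s u : Matrix (Fin R.N) (Fin R.N) ℂ}
    (hs : Module.End.IsSemisimple (Matrix.toLin' s)) (hunit : IsUnit s)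
    (hu : IsUnipotentMatrix u) (hc : Commute s u) (h : R.mat m = s * u) (a : ℕ) (b : ℂ) :
    ∃ c : H, R.mat c = s ^ a * NormedSpace.exp (b • unipotentLog u) := by
  refine R.exists_mat_eq_of_mem (R.zariskiClosed.pow_mul_exp_mem hs hunit hu hc (fun n => ?_) a b)
  exact ⟨R.ρ (m ^ n), ⟨_, rfl⟩, by rw [← h, ← mat_pow]; rfl⟩

theorem isSemisimple_one : R.IsSemisimple 1 := by
  unfold IsSemisimple
  rw [mat_one, Matrix.toLin'_one]
  exact Module.End.isSemisimple_id

theorem exists_mat_eq_exp_smul_log {u : H} (hu : R.IsUnipotent u) (b : ℂ) :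
    ∃ c : H, R.mat c = NormedSpace.exp (b • R.log u) := by
  obtain ⟨c, hc⟩ := R.exists_mat_eq_pow_mul_exp u (s := 1) (u := R.mat u)
    (by simpa only [IsSemisimple, mat_one] using R.isSemisimple_one) isUnit_one hu (Commute.one_left _)
    (by simp) 0 b
  exact ⟨c, by simpa [log_eq] using hc⟩

theorem commute_log {u v : H} (h : Commute u v) : Commute (R.log u) (R.log v) :=
  commute_unipotentLog (R.commute_mat h)

theorem exists_mat_eq_exp_sum {ι : Type*} (t : Finset ι) (z : ι → ℂ) {u : ι → H}
    (hu : ∀ j, R.IsUnipotent (u j)) (hc : ∀ i j, Commute (u i) (u j)) :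
    ∃ c : H, R.mat c = NormedSpace.exp (∑ j ∈ t, z j • R.log (u j)) := by
  classical
  induction t using Finset.induction_on with
  | empty => exact ⟨1, by simp⟩
  | insert a t ha ih =>
    obtain ⟨c, hc1⟩ := ih
    obtain ⟨d, hd⟩ := R.exists_mat_eq_exp_smul_log (hu a) (z a)
    refine ⟨d * c, ?_⟩
    rw [Finset.sum_insert ha, exp_add_of_commute, mat_mul, hd, hc1]
    exact Commute.sum_right _ _ _ fun j _ =>
      ((R.commute_log (hc a j)).smul_left _).smul_right _

theorem exists_isExpLog {k : ℕ} (z : Fin k → ℂ) {u : Fin k → H}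
    (hu : ∀ j, R.IsUnipotent (u j)) (hc : ∀ i j, Commute (u i) (u j)) :
    ∃ c : H, R.IsExpLog z u c := by
  obtain ⟨c, h⟩ := R.exists_mat_eq_exp_sum Finset.univ
    (fun j => (-1 / (2 * Real.pi * Complex.I) : ℂ) * z j) hu hc
  exact ⟨c, by rw [IsExpLog, h, Finset.smul_sum]; simp only [smul_smul]⟩

theorem IsExpLog.unique {k : ℕ} {z : Fin k → ℂ} {u : Fin k → H} {c c' : H}
    (h : R.IsExpLog z u c) (h' : R.IsExpLog z u c') : c = c' :=
  R.mat_injective (h.trans h'.symm)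

theorem isNilpotent_sum_log {k : ℕ} (z : Fin k → ℂ) {u : Fin k → H}
    (hu : ∀ j, R.IsUnipotent (u j)) (hc : ∀ i j, Commute (u i) (u j)) :
    IsNilpotent ((-1 / (2 * Real.pi * Complex.I) : ℂ) • ∑ j, z j • R.log (u j)) :=
  (isNilpotent_sum_of_commute _ _
    (fun j _ => (isNilpotent_unipotentLog (hu j)).smul (z j))
    fun i j => ((R.commute_log (hc i j)).smul_left _).smul_right _).smul _

variable {R}

theorem IsExpLog.add {k : ℕ} {z z' : Fin k → ℂ} {u : Fin k → H} {c c' : H}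
    (hc : ∀ i j, Commute (u i) (u j)) (h : R.IsExpLog z u c) (h' : R.IsExpLog z' u c') :
    R.IsExpLog (z + z') u (c * c') := by
  unfold IsExpLog at *
  rw [mat_mul, h, h', ← exp_add_of_commute, ← smul_add, ← Finset.sum_add_distrib]
  · simp only [Pi.add_apply, add_smul]
  · refine ((Commute.sum_left _ _ _ fun i _ => Commute.sum_right _ _ _ fun j _ => ?_).smul_left
      _).smul_right _
    exact ((R.commute_log (hc i j)).smul_left _).smul_right _

theorem isExpLog_zero {k : ℕ} (u : Fin k → H) : R.IsExpLog 0 u 1 := by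
  simp [IsExpLog]

theorem IsExpLog.conj {k : ℕ} {z : Fin k → ℂ} {u : Fin k → H} {c : H} (h : R.IsExpLog z u c)
    (a : H) : R.IsExpLog z (fun j => a⁻¹ * u j * a) (a⁻¹ * c * a) := by
  unfold IsExpLog at *
  have e : ∀ j, R.log (a⁻¹ * u j * a) = R.mat a⁻¹ * R.log (u j) * R.mat a := fun j => by
    rw [log_eq, mat_mul, mat_mul, unipotentLog_conj (R.mat_inv_mul_mat a), log_eq]
  let U : (Matrix (Fin R.N) (Fin R.N) ℂ)ˣ := ⟨_, _, R.mat_inv_mul_mat a, R.mat_mul_mat_inv a⟩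
  have := Matrix.exp_units_conj U
    ((-1 / (2 * Real.pi * Complex.I) : ℂ) • ∑ j, z j • R.log (u j))
  rw [mat_mul, mat_mul, h]
  refine this.symm.trans ?_
  congr 1
  simp only [U, e, Units.val_mk, Units.inv_mk, mul_smul_comm, smul_mul_assoc, Finset.mul_sum,
    Finset.sum_mul]

theorem IsExpLog.inv {k : ℕ} {z : Fin k → ℂ} {u : Fin k → H} {c : H}
    (hu : ∀ j, R.IsUnipotent (u j)) (h : R.IsExpLog z u c) :
    R.IsExpLog z (fun j => (u j)⁻¹) c⁻¹ := by
  unfold IsExpLog at *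
  have e : ∀ j, R.log (u j)⁻¹ = -R.log (u j) := fun j =>
    unipotentLog_of_mul_eq_one (hu j) (R.mat_mul_mat_inv (u j))
  simp only [e, smul_neg, Finset.sum_neg_distrib]
  rw [Matrix.exp_neg, ← h, Matrix.inv_eq_right_inv (R.mat_mul_mat_inv c)]

theorem IsExpLog.commute {k : ℕ} {z : Fin k → ℂ} {u : Fin k → H} {c a : H}
    (hu : ∀ j, R.IsUnipotent (u j)) (hc : ∀ i j, Commute (u i) (u j))
    (h : R.IsExpLog z u c) (ha : ∀ j, Commute a (u j)) : Commute a c := by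
  refine R.commute_of_mat ?_
  rw [h]
  refine commute_exp_right (R.isNilpotent_sum_log z hu hc) ?_
  exact (Commute.sum_right _ _ _ fun j _ =>
    (commute_unipotentLog_right (R.commute_mat (ha j))).smul_right _).smul_right _

theorem IsUnipotent.inv {u : H} (hu : R.IsUnipotent u) : R.IsUnipotent u⁻¹ :=
  IsUnipotentMatrix.of_mul_eq_one hu (R.mat_mul_mat_inv u)

theorem IsUnipotent.mul {u v : H} (hu : R.IsUnipotent u) (hv : R.IsUnipotent v)
    (h : Commute u v) : R.IsUnipotent (u * v) := by
  unfold IsUnipotent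
  rw [mat_mul]
  exact IsUnipotentMatrix.mul hu hv (R.commute_mat h)

theorem IsSemisimple.mul {s t : H} (hs : R.IsSemisimple s) (ht : R.IsSemisimple t)
    (h : Commute s t) : R.IsSemisimple (s * t) := by
  unfold IsSemisimple
  rw [mat_mul, Matrix.toLin'_mul]
  exact Module.End.IsSemisimple.mul_of_commute
    ((R.commute_mat h).map (Matrix.toLinAlgEquiv' (R := ℂ) (n := Fin R.N))) hs ht

theorem IsJordanChevalley.unique {m s u s' u' : H} (h : R.IsJordanChevalley m s u)
    (h' : R.IsJordanChevalley m s' u') : s = s' ∧ u = u' := by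
  obtain ⟨hs, hu, hm, hc⟩ := h
  obtain ⟨hs', hu', hm', hc'⟩ := h'
  have := jordanChevalley_unique hs hs' hu hu' (R.commute_mat hc) (R.commute_mat hc')
    (R.isUnit_mat s) (by rw [← mat_mul, ← mat_mul, ← hm, ← hm'])
  exact ⟨R.mat_injective this.1, R.mat_injective this.2⟩

/-- For elements with a given characteristic polynomial, the Jordan–Chevalley
decomposition exists in the group, and the semisimple part is a fixed polynomial in the matrix. -/
theorem exists_isJordanChevalley_polynomial (R : ReductiveGroup F H) {χ : Polynomial ℂ}
    (hχ : χ ≠ 0) :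
    ∃ q : Polynomial ℂ, ∀ m : H, (R.mat m).charpoly = χ → ∃ s u : H, R.IsJordanChevalley m s u ∧
      R.mat s = Polynomial.aeval (R.mat m) q := by
  obtain ⟨q, hq⟩ := exists_semisimplePart_polynomial R.N hχ
  refine ⟨q, fun m hm => ?_⟩
  obtain ⟨hs, hn⟩ := hq (R.mat m) (by rw [← hm]; exact Matrix.aeval_self_charpoly _)
  set A := R.mat m
  set S := Polynomial.aeval A q
  have hAS : Commute A S := commute_aeval (Commute.refl A) q
  -- S differs from the unit A by a nilpotent matrix commuting with A.
  have hSu : IsUnit S := by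
    have := IsNilpotent.isUnit_add_right_of_commute hn.neg (R.isUnit_mat m)
      ((Commute.refl A).sub_right hAS).neg_right.symm
    simpa [A] using this
  obtain ⟨T, hT⟩ := hSu
  have hTA : Commute (↑T⁻¹ : Matrix (Fin R.N) (Fin R.N) ℂ) A := by
    rw [← hT] at hAS
    exact hAS.symm.units_inv_left
  set V : Matrix (Fin R.N) (Fin R.N) ℂ := (↑T⁻¹ : Matrix (Fin R.N) (Fin R.N) ℂ) * A
  have hSV : S * V = A := by rw [← hT]; simp [V]
  have hcSV : Commute S V := by
    rw [← hT] at hAS ⊢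
    exact (Commute.refl _).units_inv_right.mul_right hAS.symm
  have hV : IsUnipotentMatrix V := by
    -- The additive nilpotent part A - S becomes multiplicative on division by S.
    have e : V - 1 = (↑T⁻¹ : Matrix (Fin R.N) (Fin R.N) ℂ) * (A - S) := by rw [mul_sub, ← hT, Units.inv_mul]
    unfold IsUnipotentMatrix
    rw [e]
    refine Commute.isNilpotent_mul_left ?_ hn
    rw [← hT]
    exact hTA.sub_right (Commute.refl _).units_inv_left
  obtain ⟨s, hs1⟩ := R.exists_mat_eq_pow_mul_exp m hs (hT ▸ T.isUnit) hV hcSV hSV.symm 1 0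
  obtain ⟨u, hu1⟩ := R.exists_mat_eq_pow_mul_exp m hs (hT ▸ T.isUnit) hV hcSV hSV.symm 0 1
  simp only [pow_one, zero_smul, NormedSpace.exp_zero, mul_one] at hs1
  simp only [pow_zero, one_smul, one_mul, exp_unipotentLog hV] at hu1
  refine ⟨s, u, ⟨?_, ?_, ?_, ?_⟩, hs1⟩
  · rw [IsSemisimple, hs1]; exact hs
  · rw [IsUnipotent, hu1]; exact hV
  · exact R.mat_injective (by rw [mat_mul, hs1, hu1, hSV])
  · exact R.mat_injective (by rw [mat_mul, mat_mul, hs1, hu1, hcSV.eq])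

theorem exists_isJordanChevalley (R : ReductiveGroup F H) (m : H) :
    ∃ s u : H, R.IsJordanChevalley m s u := by
  obtain ⟨q, hq⟩ := R.exists_isJordanChevalley_polynomial (R.mat m).charpoly_monic.ne_zero
  obtain ⟨s, u, h, -⟩ := hq m rfl
  exact ⟨s, u, h⟩

/-- The Jordan components of `m` commute with everything that commutes with `m`. -/
theorem IsJordanChevalley.commute {m s u a : H} (h : R.IsJordanChevalley m s u)
    (ha : Commute a m) : Commute a s ∧ Commute a u := by
  obtain ⟨q, hq⟩ := R.exists_isJordanChevalley_polynomial (R.mat m).charpoly_monic.ne_zero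
  obtain ⟨s', u', h', hs'⟩ := hq m rfl
  obtain ⟨rfl, rfl⟩ := h.unique h'
  have h1 : Commute a s := by
    refine R.commute_of_mat ?_
    rw [hs']
    exact commute_aeval (R.commute_mat ha) q
  refine ⟨h1, ?_⟩
  have e : u = s⁻¹ * m := by rw [h.2.2.1]; group
  rw [e]
  exact h1.inv_right.mul_right ha

end ReductiveGroup

/-! ### Holomorphic matrix-valued maps -/

section HolomorphicMatrices

variable {EM HM M : Type*} [NormedAddCommGroup EM] [NormedSpace ℂ EM] [TopologicalSpace HM]
  {I : ModelWithCorners ℂ EM HM} [TopologicalSpace M] [ChartedSpace HM M] {N : ℕ}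

variable (I) in
/-- A matrix-valued map is holomorphic at a point if its entries are. -/
def MatHolAt (f : M → Matrix (Fin N) (Fin N) ℂ) (x : M) : Prop :=
  ∀ i j, ContMDiffAt I 𝓘(ℂ, ℂ) ω (fun y => f y i j) x

namespace MatHolAt

variable {f g : M → Matrix (Fin N) (Fin N) ℂ} {x : M}

theorem const (A : Matrix (Fin N) (Fin N) ℂ) : MatHolAt I (fun _ : M => A) x :=
  fun _ _ => contMDiffAt_const

theorem sub (hf : MatHolAt I f x) (hg : MatHolAt I g x) : MatHolAt I (fun y => f y - g y) x :=
  fun i j => (hf i j).sub (hg i j)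

theorem mul (hf : MatHolAt I f x) (hg : MatHolAt I g x) : MatHolAt I (fun y => f y * g y) x := by
  intro i j
  simp only [Matrix.mul_apply]
  exact ContMDiffAt.sum fun l _ => (hf i l).mul (hg l j)

theorem smul {c : M → ℂ} (hc : ContMDiffAt I 𝓘(ℂ, ℂ) ω c x) (hf : MatHolAt I f x) :
    MatHolAt I (fun y => c y • f y) x :=
  fun i j => hc.mul (hf i j)

theorem sum {ι : Type*} {t : Finset ι} {f : ι → M → Matrix (Fin N) (Fin N) ℂ}
    (hf : ∀ l ∈ t, MatHolAt I (f l) x) : MatHolAt I (fun y => ∑ l ∈ t, f l y) x := by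
  intro i j
  simp only [Matrix.sum_apply]
  exact ContMDiffAt.sum fun l hl => hf l hl i j

theorem pow (hf : MatHolAt I f x) (n : ℕ) : MatHolAt I (fun y => f y ^ n) x := by
  induction n with
  | zero => simpa using MatHolAt.const 1
  | succ n ih => simpa only [pow_succ] using ih.mul hf

theorem unipotentLog (hf : MatHolAt I f x) : MatHolAt I (fun y => unipotentLog (f y)) x :=
  MatHolAt.sum fun _ _ => MatHolAt.smul contMDiffAt_const ((hf.sub (const 1)).pow _)

theorem exp (hf : MatHolAt I f x) (hn : ∀ y, IsNilpotent (f y)) :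
    MatHolAt I (fun y => NormedSpace.exp (f y)) x := by
  simp only [exp_eq_sum_of_isNilpotent (hn _)]
  exact MatHolAt.sum fun m _ => MatHolAt.smul contMDiffAt_const (hf.pow m)

theorem aeval (hf : MatHolAt I f x) (q : Polynomial ℂ) :
    MatHolAt I (fun y => Polynomial.aeval (f y) q) x := by
  simp only [Polynomial.aeval_eq_sum_range]
  exact MatHolAt.sum fun m _ => MatHolAt.smul contMDiffAt_const (hf.pow m)

end MatHolAt

variable {F H : Type*} [NormedAddCommGroup F] [NormedSpace ℂ F]
  [TopologicalSpace H] [ChartedSpace F H] [Group H] (R : ReductiveGroup F H)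

/-- A map into a reductive group is holomorphic if and only if its matrix is. -/
theorem ReductiveGroup.contMDiffAt_iff {f : M → H} {x : M} :
    ContMDiffAt I 𝓘(ℂ, F) ω f x ↔ MatHolAt I (fun y => R.mat (f y)) x := by
  have h1 : MatHolAt I (fun y => R.mat (f y)) x ↔ ContMDiffAt I 𝓘(ℂ, Fin R.N → Fin R.N → ℂ) ω
      ((fun h a b => (R.ρ h : Matrix (Fin R.N) (Fin R.N) ℂ) a b) ∘ f) x := by
    simp only [contMDiffAt_pi_space]
    rfl
  -- Testing holomorphy after an immersion presupposes continuity, which the topological embedding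
  -- supplies.
  rw [h1, ContMDiffAt.iff_comp_isImmersionAt (R.embedding.isImmersion.isImmersionAt (f x)),
    and_iff_right_iff_imp]
  intro h
  rw [R.embedding.isEmbedding.isInducing.continuousAt_iff]
  exact h.continuousAt

end HolomorphicMatrices

/-! ### Frames of principal bundles and arrows of the Atiyah groupoid -/

namespace PrincipalBundle

variable {E X F H : Type*}
  [NormedAddCommGroup E] [NormedSpace ℂ E] [NormedAddCommGroup F] [NormedSpace ℂ F]
  [TopologicalSpace X] [ChartedSpace E X] [TopologicalSpace H] [ChartedSpace F H] [Group H]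
  (P : PrincipalBundle.{w} E X F H)

theorem act_injective {p : P.carrier} {h h' : H} (e : P.act p h = P.act p h') : h = h' := by
  obtain ⟨W, -, hxW, t, hsrc, -, -, ht, -⟩ := P.locally_trivial (P.proj p)
  have hp : p ∈ t.source := by rw [hsrc]; exact hxW
  have := ht p hp h
  rw [e, ht p hp h'] at this
  exact (mul_left_cancel this).symm

theorem exists_act_eq {p q : P.carrier} (e : P.proj p = P.proj q) : ∃ h, P.act p h = q := by
  obtain ⟨W, -, hxW, t, hsrc, -, hpr, ht, -⟩ := P.locally_trivial (P.proj p)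
  have hp : p ∈ t.source := by rw [hsrc]; exact hxW
  have hq : q ∈ t.source := by rw [hsrc, Set.mem_preimage, ← e]; exact hxW
  have hph : ∀ h, P.act p h ∈ t.source := fun h => by
    rw [hsrc, Set.mem_preimage, P.proj_act]; exact hxW
  refine ⟨(t p).2⁻¹ * (t q).2, t.injOn (hph _) hq (Prod.ext ?_ ?_)⟩
  · rw [hpr _ (hph _), hpr _ hq, P.proj_act, e]
  · rw [ht p hp, mul_inv_cancel_left]

theorem exists_proj_eq (x : X) : ∃ p, P.proj p = x := by
  obtain ⟨W, -, hxW, t, -, htgt, hpr, -⟩ := P.locally_trivial x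
  have hx : (x, (1 : H)) ∈ t.target := by rw [htgt]; exact ⟨hxW, trivial⟩
  exact ⟨t.symm (x, 1), by rw [← hpr _ (t.map_target hx), t.right_inv hx]⟩

open Classical in
/-- The element of the structure group that takes the frame `p` to the frame `q`. -/
def div (p q : P.carrier) : H :=
  if h : ∃ h, P.act p h = q then h.choose else 1

theorem act_div {p q : P.carrier} (e : P.proj p = P.proj q) : P.act p (P.div p q) = q := by
  have h := P.exists_act_eq e
  rw [div, dif_pos h]
  exact h.choose_spec

theorem div_act (p : P.carrier) (h : H) : P.div p (P.act p h) = h :=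
  P.act_injective (P.act_div (P.proj_act p h).symm)

theorem contMDiffAt_act {EM HM M : Type*} [NormedAddCommGroup EM] [NormedSpace ℂ EM]
    [TopologicalSpace HM] {I : ModelWithCorners ℂ EM HM} [TopologicalSpace M] [ChartedSpace HM M]
    {a : M → P.carrier} {b : M → H} {x : M}
    (ha : ContMDiffAt I (𝓘(ℂ, E).prod 𝓘(ℂ, F)) ω a x) (hb : ContMDiffAt I 𝓘(ℂ, F) ω b x) :
    ContMDiffAt I (𝓘(ℂ, E).prod 𝓘(ℂ, F)) ω (fun y => P.act (a y) (b y)) x :=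
  P.act_holomorphic.contMDiffAt.comp x (ha.prodMk hb)

/-- In a local trivialization the quotient of two frames is (t a).2⁻¹ (t b).2. -/
theorem contMDiffAt_div [LieGroup 𝓘(ℂ, F) ω H] {EM HM M : Type*} [NormedAddCommGroup EM]
    [NormedSpace ℂ EM] [TopologicalSpace HM] {I : ModelWithCorners ℂ EM HM} [TopologicalSpace M]
    [ChartedSpace HM M] {a b : M → P.carrier} {x : M}
    (ha : ContMDiffAt I (𝓘(ℂ, E).prod 𝓘(ℂ, F)) ω a x)
    (hb : ContMDiffAt I (𝓘(ℂ, E).prod 𝓘(ℂ, F)) ω b x)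
    (hab : ∀ᶠ y in 𝓝 x, P.proj (a y) = P.proj (b y)) :
    ContMDiffAt I 𝓘(ℂ, F) ω (fun y => P.div (a y) (b y)) x := by
  obtain ⟨W, -, hxW, t, hsrc, -, -, ht, hhol, -⟩ := P.locally_trivial (P.proj (a x))
  have hax : a x ∈ t.source := by rw [hsrc]; exact hxW
  have hbx : b x ∈ t.source := by rw [hsrc, Set.mem_preimage, ← hab.self_of_nhds]; exact hxW
  have hta := (hhol.contMDiffAt (t.open_source.mem_nhds hax)).comp x ha
  have htb := (hhol.contMDiffAt (t.open_source.mem_nhds hbx)).comp x hb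
  have h1 := (contMDiffAt_snd.comp x hta).inv.mul (contMDiffAt_snd.comp x htb)
  refine h1.congr_of_eventuallyEq ?_
  filter_upwards [hab, ha.continuousAt.preimage_mem_nhds (t.open_source.mem_nhds hax)]
    with y hy hys
  have h2 := ht (a y) hys (P.div (a y) (b y))
  rw [P.act_div hy] at h2
  simp [h2]

variable {P}

theorem arrow_eq_iff {q p q' p' : P.carrier} :
    P.arrow q p = P.arrow q' p' ↔ ∃ h, q' = P.act q h ∧ p' = P.act p h := by
  refine (Quotient.eq (r := P.pairSetoid)).trans ⟨?_, ?_⟩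
  · rintro ⟨h, e⟩
    exact ⟨h, congrArg Prod.fst e, congrArg Prod.snd e⟩
  · rintro ⟨h, e, e'⟩
    exact ⟨h, Prod.ext e e'⟩

theorem arrow_act (q p : P.carrier) (h : H) : P.arrow (P.act q h) (P.act p h) = P.arrow q p :=
  (arrow_eq_iff.mpr ⟨h, rfl, rfl⟩).symm

theorem arrow_left_injective {q q' p : P.carrier} (h : P.arrow q p = P.arrow q' p) : q = q' := by
  obtain ⟨a, e, e'⟩ := arrow_eq_iff.mp h
  have : a = 1 := P.act_injective (by rw [← e', P.act_one])
  rw [e, this, P.act_one]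

namespace Atiyah

@[simp] theorem src_arrow (q p : P.carrier) : (P.arrow q p).src = P.proj p := rfl

@[simp] theorem tgt_arrow (q p : P.carrier) : (P.arrow q p).tgt = P.proj q := rfl

@[simp] theorem inv_arrow (q p : P.carrier) : (P.arrow q p).inv = P.arrow p q := rfl

theorem exists_eq_arrow_of_src {a : P.Atiyah} {p : P.carrier} (h : a.src = P.proj p) :
    ∃ q, a = P.arrow q p := by
  induction a using Quotient.inductionOn with
  | h b =>
    obtain ⟨c, hc⟩ := P.exists_act_eq (p := b.2) (q := p) h
    exact ⟨P.act b.1 c, by rw [← hc, arrow_act]; rfl⟩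

theorem exists_eq_arrow_of_tgt {a : P.Atiyah} {q : P.carrier} (h : a.tgt = P.proj q) :
    ∃ p, a = P.arrow q p := by
  induction a using Quotient.inductionOn with
  | h b =>
    obtain ⟨c, hc⟩ := P.exists_act_eq (p := b.1) (q := q) h
    exact ⟨P.act b.2 c, by rw [← hc, arrow_act]; rfl⟩

theorem isComp_arrow (r q p : P.carrier) : (P.arrow r q).IsComp (P.arrow q p) (P.arrow r p) :=
  ⟨p, q, r, rfl, rfl, rfl⟩

theorem IsComp.eq_arrow {r q p : P.carrier} {c : P.Atiyah}
    (h : (P.arrow r q).IsComp (P.arrow q p) c) : c = P.arrow r p := by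
  obtain ⟨p', q', r', h1, h2, rfl⟩ := h
  obtain ⟨a, rfl, rfl⟩ := arrow_eq_iff.mp h1
  obtain ⟨b, hb, rfl⟩ := arrow_eq_iff.mp h2
  rw [P.act_injective hb, arrow_act]

end Atiyah

end PrincipalBundle

/-! ### Exponential sections on the lattice -/

theorem lattice_add {k : ℕ} (n n' : Fin k → ℤ) : lattice (n + n') = lattice n + lattice n' := by
  ext j; simp [lattice]; ring

theorem lattice_zero {k : ℕ} : lattice (0 : Fin k → ℤ) = 0 := by
  ext j; simp [lattice]

theorem lattice_neg {k : ℕ} (n : Fin k → ℤ) : lattice (-n) = -lattice n := by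
  ext j; simp [lattice]

namespace ReductiveGroup

variable {F H : Type*} [NormedAddCommGroup F] [NormedSpace ℂ F]
  [TopologicalSpace H] [ChartedSpace F H] [Group H] {R : ReductiveGroup F H} {k : ℕ}

theorem IsExpLog.neg {z : Fin k → ℂ} {u : Fin k → H} {c : H} (h : R.IsExpLog z u c) :
    R.IsExpLog (-z) u c⁻¹ := by
  unfold IsExpLog at *
  simp only [Pi.neg_apply, neg_smul, Finset.sum_neg_distrib, smul_neg]
  rw [Matrix.exp_neg, ← h, Matrix.inv_eq_right_inv (R.mat_mul_mat_inv c)]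

/-- The factor 2πi of the lattice vector cancels the normalization -1/(2πi) and leaves the sign,
hence the inverse of u_j. -/
theorem isExpLog_single {u : Fin k → H} (j : Fin k) (hu : R.IsUnipotent (u j)) :
    R.IsExpLog (lattice (Pi.single j 1)) u (u j)⁻¹ := by
  unfold IsExpLog
  have e : (-1 / (2 * Real.pi * Complex.I) : ℂ) • ∑ i, lattice (Pi.single j 1) i • R.log (u i)
      = -R.log (u j) := by
    rw [Finset.sum_eq_single j]
    · have h : (2 * Real.pi * Complex.I : ℂ) ≠ 0 := Complex.two_pi_I_ne_zero
      rw [smul_smul, lattice, Pi.single_eq_same, Int.cast_one, mul_one, div_mul_cancel₀ _ h,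
        neg_one_smul]
    · intro i _ hij
      simp [lattice, hij]
    · simp
  rw [e, Matrix.exp_neg, log_eq, exp_unipotentLog hu, Matrix.inv_eq_right_inv (R.mat_mul_mat_inv _)]

/-- On the lattice `2πi ℤ^k`, the exponential section of a unipotent representation of `ℤ^k` is
the inverse of the representation. -/
theorem isExpLog_lattice {u : (Fin k → ℤ) → H} (hadd : ∀ n n', u (n + n') = u n * u n')
    (hu : ∀ n, R.IsUnipotent (u n)) (n : Fin k → ℤ) :
    R.IsExpLog (lattice n) (fun j => u (Pi.single j 1)) (u n)⁻¹ := by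
  have hc : ∀ n n', Commute (u n) (u n') := fun n n' => by
    rw [Commute, SemiconjBy, ← hadd, ← hadd, add_comm]
  have h0 : u 0 = 1 := by
    have := hadd 0 0
    rw [add_zero] at this
    exact left_eq_mul.mp this
  have hneg : ∀ n, u (-n) = (u n)⁻¹ := fun n =>
    eq_inv_of_mul_eq_one_left (by rw [← hadd, neg_add_cancel, h0])
  -- The n for which the formula holds form a subgroup, so the basis vectors suffice.
  let S : AddSubgroup (Fin k → ℤ) :=
    { carrier := {n | R.IsExpLog (lattice n) (fun j => u (Pi.single j 1)) (u n)⁻¹}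
      zero_mem' := by
        rw [Set.mem_ofPred_eq, lattice_zero, h0, inv_one]
        exact isExpLog_zero _
      add_mem' := fun {a b} ha hb => by
        rw [Set.mem_ofPred_eq, lattice_add, hadd, (hc a b).eq, mul_inv_rev]
        exact IsExpLog.add (fun i j => hc _ _) ha hb
      neg_mem' := fun {a} ha => by
        rw [Set.mem_ofPred_eq, lattice_neg, hneg]
        exact IsExpLog.neg ha }
  have hmem : n ∈ S := by
    rw [← Finset.univ_sum_single n]
    refine AddSubgroup.sum_mem _ fun j _ => ?_
    have : (Pi.single j (n j) : Fin k → ℤ) = n j • Pi.single j 1 := by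
      rw [← Pi.single_smul]; simp
    rw [this]
    exact AddSubgroup.zsmul_mem _ (isExpLog_single (u := fun j => u (Pi.single j 1)) j (hu _)) _
  exact hmem

end ReductiveGroup

/-! ### Twisting a representation by a family of unipotent gauge transformations -/

section Twist

variable {E EG X G F H : Type*}
  [NormedAddCommGroup E] [NormedSpace ℂ E] [NormedAddCommGroup EG] [NormedSpace ℂ EG]
  [NormedAddCommGroup F] [NormedSpace ℂ F]
  [TopologicalSpace X] [ChartedSpace E X] [TopologicalSpace G] [ChartedSpace EG G]
  [TopologicalSpace H] [ChartedSpace F H] [Group H]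
  {k : ℕ} [MulAction (Fin k → ℂˣ) X]

theorem expTorus_lattice (n : Fin k → ℤ) : expTorus (lattice n) = 1 := by
  ext j
  simp only [expTorus, lattice, Units.val_mk0, Pi.one_apply, Units.val_one]
  rw [mul_comm]
  exact Complex.exp_int_mul_two_pi_mul_I (n j)

theorem HomogeneousGroupoid.tgt_i_lattice (𝒢 : HomogeneousGroupoid E EG X G k) (n : Fin k → ℤ)
    (x : X) : 𝒢.tgt (𝒢.i (lattice n, x)) = x := by
  rw [𝒢.tgt_i, expTorus_lattice, one_smul]

theorem HomogeneousGroupoid.π_one (𝒢 : HomogeneousGroupoid E EG X G k) (x : X) :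
    𝒢.π (𝒢.one x) = 0 := by
  rw [← 𝒢.i_zero, 𝒢.π_i]

/-- A family of commuting unipotent gauge transformations of `P`, indexed by `ℤ^k` and invariant
under the representation `φ`: `u n p` is the matrix of the `n`-th transformation in the
frame `p`. -/
structure UnipotentFamily {𝒢 : HomogeneousGroupoid E EG X G k} (R : ReductiveGroup F H)
    {P : PrincipalBundle.{w} E X F H} (φ : RepOn 𝒢.toHolLieGroupoid P) where
  /-- the transformation in frames -/
  u : (Fin k → ℤ) → P.carrier → H
  map_add : ∀ n n' p, u (n + n') p = u n p * u n' p
  conj : ∀ n p h, u n (P.act p h) = h⁻¹ * u n p * h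
  holomorphic : ∀ n, ContMDiff (𝓘(ℂ, E).prod 𝓘(ℂ, F)) 𝓘(ℂ, F) ω (u n)
  invariant : ∀ n g q p, φ.toFun g = P.arrow q p → u n q = u n p
  unipotent : ∀ n p, R.IsUnipotent (u n p)

theorem RepOn.exists_eq_arrow {𝒢 : HolLieGroupoid E EG X G} {P : PrincipalBundle.{w} E X F H}
    (φ : RepOn 𝒢 P) {g : G} {p : P.carrier} (h : P.proj p = 𝒢.src g) :
    ∃ q, φ.toFun g = P.arrow q p ∧ P.proj q = 𝒢.tgt g := by
  obtain ⟨q, hq⟩ := PrincipalBundle.Atiyah.exists_eq_arrow_of_src ((φ.src_toFun g).trans h.symm)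
  exact ⟨q, hq, by rw [← φ.tgt_toFun, hq]; rfl⟩

theorem RepOn.exists_eq_arrow_of_tgt {𝒢 : HolLieGroupoid E EG X G}
    {P : PrincipalBundle.{w} E X F H} (φ : RepOn 𝒢 P) {g : G} {q : P.carrier}
    (h : P.proj q = 𝒢.tgt g) : ∃ p, φ.toFun g = P.arrow q p ∧ P.proj p = 𝒢.src g := by
  obtain ⟨p, hp⟩ := PrincipalBundle.Atiyah.exists_eq_arrow_of_tgt ((φ.tgt_toFun g).trans h.symm)
  exact ⟨p, hp, by rw [← φ.src_toFun, hp]; rfl⟩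

theorem RepOn.map_mul_eq {𝒢 : HolLieGroupoid E EG X G} {P : PrincipalBundle.{w} E X F H}
    (φ : RepOn 𝒢 P) {g h : G} {r q p : P.carrier} (hgh : 𝒢.src g = 𝒢.tgt h)
    (hg : φ.toFun g = P.arrow r q) (hh : φ.toFun h = P.arrow q p) :
    φ.toFun (𝒢.mul g h) = P.arrow r p := by
  have := φ.map_mul g h hgh
  rw [hg, hh] at this
  exact this.eq_arrow

namespace UnipotentFamily

variable {𝒢 : HomogeneousGroupoid E EG X G k} {R : ReductiveGroup F H}
  {P : PrincipalBundle.{w} E X F H} {φ : RepOn 𝒢.toHolLieGroupoid P}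
  (W : UnipotentFamily R φ)

theorem commute (n n' : Fin k → ℤ) (p : P.carrier) : Commute (W.u n p) (W.u n' p) := by
  rw [Commute, SemiconjBy, ← W.map_add, ← W.map_add, add_comm]

theorem map_zero (p : P.carrier) : W.u 0 p = 1 := by
  have := W.map_add 0 0 p
  rw [add_zero] at this
  exact left_eq_mul.mp this

theorem conj_of_commute {n : Fin k → ℤ} {p : P.carrier} {h : H} (hc : Commute (W.u n p) h) :
    W.u n (P.act p h) = W.u n p := by
  rw [W.conj, mul_assoc, hc.eq, inv_mul_cancel_left]

theorem exists_coc (g : G) (q : P.carrier) :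
    ∃ c : H, R.IsExpLog (𝒢.π g) (fun j => W.u (Pi.single j 1) q) c :=
  R.exists_isExpLog _ (fun _ => W.unipotent _ _) fun _ _ => W.commute _ _ _

/-- The exponential section in frames. -/
def coc (g : G) (q : P.carrier) : H := (W.exists_coc g q).choose

theorem isExpLog_coc (g : G) (q : P.carrier) :
    R.IsExpLog (𝒢.π g) (fun j => W.u (Pi.single j 1) q) (W.coc g q) :=
  (W.exists_coc g q).choose_spec

theorem coc_eq {g : G} {q : P.carrier} {c : H}
    (h : R.IsExpLog (𝒢.π g) (fun j => W.u (Pi.single j 1) q) c) : W.coc g q = c :=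
  (W.isExpLog_coc g q).unique R h

theorem coc_act (g : G) (q : P.carrier) (h : H) :
    W.coc g (P.act q h) = h⁻¹ * W.coc g q * h := by
  refine W.coc_eq ?_
  simp only [W.conj]
  exact (W.isExpLog_coc g q).conj h

theorem coc_invariant (g : G) {g' : G} {q p : P.carrier} (h : φ.toFun g' = P.arrow q p) :
    W.coc g q = W.coc g p := by
  refine W.coc_eq ?_
  simp only [W.invariant _ _ _ _ h]
  exact W.isExpLog_coc g p

/-- Additivity of π and commuting logarithms make the section multiplicative in a fixed frame;
`coc_invariant` moves the frame along φ, and together they give the cocycle identity. -/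
theorem coc_mul {g h : G} (hgh : 𝒢.src g = 𝒢.tgt h) (q : P.carrier) :
    W.coc (𝒢.mul g h) q = W.coc g q * W.coc h q := by
  refine W.coc_eq ?_
  rw [𝒢.π_mul g h hgh]
  exact (W.isExpLog_coc g q).add (fun _ _ => W.commute _ _ _) (W.isExpLog_coc h q)

theorem coc_one (x : X) (q : P.carrier) : W.coc (𝒢.one x) q = 1 := by
  refine W.coc_eq ?_
  rw [𝒢.π_one]
  exact ReductiveGroup.isExpLog_zero _

theorem commute_coc {a : H} {q : P.carrier} (g : G) (h : ∀ n, Commute a (W.u n q)) :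
    Commute a (W.coc g q) :=
  (W.isExpLog_coc g q).commute (fun _ => W.unipotent _ _) (fun _ _ => W.commute _ _ _)
    fun _ => h _

theorem coc_lattice (n : Fin k → ℤ) (x : X) (q : P.carrier) :
    W.coc (𝒢.i (lattice n, x)) q = (W.u n q)⁻¹ := by
  refine W.coc_eq ?_
  rw [𝒢.π_i]
  exact ReductiveGroup.isExpLog_lattice (u := fun n => W.u n q) (fun n n' => W.map_add n n' q)
    (fun n => W.unipotent n q) n

theorem contMDiffAt_coc {a : G → P.carrier} {g : G}
    (ha : ContMDiffAt 𝓘(ℂ, EG) (𝓘(ℂ, E).prod 𝓘(ℂ, F)) ω a g) :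
    ContMDiffAt 𝓘(ℂ, EG) 𝓘(ℂ, F) ω (fun y => W.coc y (a y)) g := by
  rw [R.contMDiffAt_iff]
  have e : (fun y => R.mat (W.coc y (a y))) = fun y => NormedSpace.exp
      ((-1 / (2 * Real.pi * Complex.I) : ℂ) •
        ∑ j, 𝒢.π y j • R.log (W.u (Pi.single j 1) (a y))) :=
    funext fun y => W.isExpLog_coc y (a y)
  rw [e]
  refine MatHolAt.exp (MatHolAt.smul contMDiffAt_const (MatHolAt.sum fun j _ =>
    MatHolAt.smul ?_ (MatHolAt.unipotentLog ?_))) fun y => ?_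
  · exact (contMDiffAt_pi_space.mp 𝒢.π_holomorphic.contMDiffAt) j
  · rw [← R.contMDiffAt_iff]
    exact (W.holomorphic _).contMDiffAt.comp g ha
  · exact R.isNilpotent_sum_log _ (fun _ => W.unipotent _ _) fun _ _ => W.commute _ _ _

/-- Equivariance in the frame is what lets the section and the twist descend to classes in the
Atiyah groupoid. -/
theorem act_coc_act (g : G) (q : P.carrier) (h : H) :
    P.act (P.act q h) (W.coc g (P.act q h)) = P.act (P.act q (W.coc g q)) h := by
  rw [W.coc_act, ← P.act_mul, ← P.act_mul]
  congr 1
  group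

/-- The section `σ_V` of the isotropy of the Atiyah groupoid. -/
def sectionFun (g : G) : P.Atiyah :=
  Quotient.liftOn (φ.toFun g) (fun b => P.arrow (P.act b.1 (W.coc g b.1)) b.1) (by
    rintro a b ⟨h, rfl⟩
    simp only [W.act_coc_act, PrincipalBundle.arrow_act])

/-- The product `σ_V φ`. -/
def twistFun (g : G) : P.Atiyah :=
  Quotient.liftOn (φ.toFun g) (fun b => P.arrow (P.act b.1 (W.coc g b.1)) b.2) (by
    rintro a b ⟨h, rfl⟩
    simp only [W.act_coc_act, PrincipalBundle.arrow_act])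

theorem twistFun_eq {g : G} {q p : P.carrier} (h : φ.toFun g = P.arrow q p) :
    W.twistFun g = P.arrow (P.act q (W.coc g q)) p := by
  rw [twistFun, h]; rfl

theorem sectionFun_eq {g : G} {q : P.carrier} (h : P.proj q = 𝒢.tgt g) :
    W.sectionFun g = P.arrow (P.act q (W.coc g q)) q := by
  obtain ⟨p, hp, -⟩ := φ.exists_eq_arrow_of_tgt h
  rw [sectionFun, hp]; rfl

/-- The representation `σ_V φ`. -/
def twist : RepOn 𝒢.toHolLieGroupoid P where
  toFun := W.twistFun
  src_toFun g := by
    obtain ⟨p, hp⟩ := P.exists_proj_eq (𝒢.src g)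
    obtain ⟨q, hq, -⟩ := φ.exists_eq_arrow hp
    rw [W.twistFun_eq hq, PrincipalBundle.Atiyah.src_arrow, hp]
  tgt_toFun g := by
    obtain ⟨p, hp⟩ := P.exists_proj_eq (𝒢.src g)
    obtain ⟨q, hq, hqt⟩ := φ.exists_eq_arrow hp
    rw [W.twistFun_eq hq, PrincipalBundle.Atiyah.tgt_arrow, P.proj_act, hqt]
  map_one p := by
    rw [W.twistFun_eq (φ.map_one p), W.coc_one, P.act_one]
  map_mul g h hgh := by
    obtain ⟨p, hp⟩ := P.exists_proj_eq (𝒢.src h)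
    obtain ⟨q, hq, hqt⟩ := φ.exists_eq_arrow hp
    obtain ⟨r, hr, -⟩ := φ.exists_eq_arrow (hqt.trans hgh.symm)
    -- The value of the section at `h` agrees in the frames `r` and `q`, so shifting the
    -- representative of the twisted `g` by it matches the middle frames.
    rw [W.twistFun_eq (φ.map_mul_eq hgh hr hq), W.twistFun_eq hq, W.twistFun_eq hr, W.coc_mul hgh,
      P.act_mul, W.coc_invariant h hr, ← PrincipalBundle.arrow_act _ q (W.coc h q)]
    exact PrincipalBundle.Atiyah.isComp_arrow _ _ _
  holomorphic g₀ := by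
    obtain ⟨S, hS, hg₀, a, b, ha, hb, h⟩ := φ.holomorphic g₀
    refine ⟨S, hS, hg₀, fun g => P.act (a g) (W.coc g (a g)), b, fun g hg => ?_, hb,
      fun g hg => W.twistFun_eq (h g hg)⟩
    have ha' := ha.contMDiffAt (hS.mem_nhds hg)
    exact (P.contMDiffAt_act ha' (W.contMDiffAt_coc ha')).contMDiffWithinAt

theorem twist_eq {g : G} {q p : P.carrier} (h : φ.toFun g = P.arrow q p) :
    W.twist.toFun g = P.arrow (P.act q (W.coc g q)) p := W.twistFun_eq h

theorem isOneCocycle : IsOneCocycle φ W.sectionFun where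
  src_eq g := by
    obtain ⟨q, hq⟩ := P.exists_proj_eq (𝒢.tgt g)
    rw [W.sectionFun_eq hq, PrincipalBundle.Atiyah.src_arrow, hq]
  tgt_eq g := by
    obtain ⟨q, hq⟩ := P.exists_proj_eq (𝒢.tgt g)
    rw [W.sectionFun_eq hq, PrincipalBundle.Atiyah.tgt_arrow, P.proj_act, hq]
  holomorphic g₀ := by
    obtain ⟨S, hS, hg₀, a, b, ha, hb, h⟩ := φ.holomorphic g₀
    refine ⟨S, hS, hg₀, fun g => P.act (a g) (W.coc g (a g)), a, fun g hg => ?_, ha,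
      fun g hg => W.sectionFun_eq ?_⟩
    · have ha' := ha.contMDiffAt (hS.mem_nhds hg)
      exact (P.contMDiffAt_act ha' (W.contMDiffAt_coc ha')).contMDiffWithinAt
    · rw [← φ.tgt_toFun, h g hg]; rfl
  cocycle g h hgh := by
    obtain ⟨q, hq⟩ := P.exists_proj_eq (𝒢.tgt h)
    obtain ⟨r, hr, hrt⟩ := φ.exists_eq_arrow (hq.trans hgh.symm)
    refine ⟨P.arrow (P.act r (W.coc g r)) q, P.arrow (P.act (P.act r (W.coc g r)) (W.coc h q)) q,
      ?_, ?_, ?_⟩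
    · rw [hr, W.sectionFun_eq hrt]
      exact PrincipalBundle.Atiyah.isComp_arrow _ _ _
    · rw [W.sectionFun_eq hq, ← PrincipalBundle.arrow_act _ q (W.coc h q)]
      exact PrincipalBundle.Atiyah.isComp_arrow _ _ _
    · rw [hr, PrincipalBundle.Atiyah.inv_arrow,
        W.sectionFun_eq (hrt.trans (𝒢.tgt_mul g h hgh).symm), W.coc_mul hgh, P.act_mul,
        W.coc_invariant h hr]
      exact PrincipalBundle.Atiyah.isComp_arrow _ _ _

theorem isTwist {V : (Fin k → ℤ) → P.carrier → P.carrier}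
    (hV : ∀ n q, V n q = P.act q (W.u n q)) : IsTwist 𝒢 R V φ W.twist := by
  refine ⟨W.sectionFun, W.isOneCocycle, fun g q hq => ?_, fun g => ?_⟩
  · exact ⟨fun j => W.u (Pi.single j 1) q, W.coc g q, fun j => hV _ _, W.isExpLog_coc g q,
      W.sectionFun_eq hq⟩
  · obtain ⟨q, hq⟩ := P.exists_proj_eq (𝒢.tgt g)
    obtain ⟨p, hp, -⟩ := φ.exists_eq_arrow_of_tgt hq
    rw [W.sectionFun_eq hq, W.twist_eq hp, hp]
    exact PrincipalBundle.Atiyah.isComp_arrow _ _ _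

/-- The section equals u_n⁻¹ on the lattice arrow, and u_n takes the same value at `p` and at the
frame p·m reached by the monodromy. -/
theorem monodromy_twist {n : Fin k → ℤ} {p : P.carrier} {m : H}
    (h : monodromy 𝒢 φ n (P.proj p) = P.arrow (P.act p m) p) :
    monodromy 𝒢 W.twist n (P.proj p) = P.arrow (P.act p (m * (W.u n p)⁻¹)) p := by
  rw [monodromy, W.twist_eq h, W.coc_lattice, W.invariant _ _ _ _ h, P.act_mul]

/-- The inverse family. -/
def inv [LieGroup 𝓘(ℂ, F) ω H] : UnipotentFamily R φ where
  u n p := (W.u n p)⁻¹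
  map_add n n' p := by rw [W.map_add, (W.commute n n' p).eq, mul_inv_rev]
  conj n p h := by rw [W.conj]; group
  holomorphic n := (W.holomorphic n).inv
  invariant n g q p h := by rw [W.invariant n g q p h]
  unipotent n p := (W.unipotent n p).inv

/-- A family that commutes with `W` is also invariant under the twist by `W`. -/
def transfer (W' : UnipotentFamily R φ) (h : ∀ n n' p, Commute (W'.u n p) (W.u n' p)) :
    UnipotentFamily R W.twist where
  u := W'.u
  map_add := W'.map_add
  conj := W'.conj
  holomorphic := W'.holomorphic
  unipotent := W'.unipotent
  invariant n g q p hqp := by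
    have hp : P.proj p = 𝒢.src g := by rw [← W.twist.src_toFun, hqp]; rfl
    obtain ⟨q₀, hq₀, -⟩ := φ.exists_eq_arrow hp
    rw [W.twist_eq hq₀] at hqp
    -- The twisted end frame is q₀·c with c built from `W`; as c commutes with `W'` at q₀, moving by
    -- c changes no value of `W'`.
    rw [← PrincipalBundle.arrow_left_injective hqp,
      W'.conj_of_commute (W.commute_coc g fun n' => h n n' q₀), W'.invariant _ _ _ _ hq₀]

/-- The second section is read in the frame q·c. The family commutes with c, so its values there are
those at q, and the inverse family contributes c⁻¹. -/
theorem twist_twist_of_inv (W' : UnipotentFamily R W.twist)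
    (h : ∀ n p, W'.u n p = (W.u n p)⁻¹) : W'.twist = φ := by
  ext g
  obtain ⟨p, hp⟩ := P.exists_proj_eq (𝒢.src g)
  obtain ⟨q, hq, -⟩ := φ.exists_eq_arrow hp
  have hc : W'.coc g (P.act q (W.coc g q)) = (W.coc g q)⁻¹ := by
    refine W'.coc_eq ?_
    simp only [h, W.conj_of_commute (W.commute_coc g fun n' => W.commute _ n' q)]
    exact (W.isExpLog_coc g q).inv fun _ => W.unipotent _ _
  rw [W'.twist_eq (W.twist_eq hq), hc, ← P.act_mul, mul_inv_cancel, P.act_one, hq]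

end UnipotentFamily

end Twist

/-! ### Jordan components in a reductive group -/

namespace ReductiveGroup

variable {F H : Type*} [NormedAddCommGroup F] [NormedSpace ℂ F]
  [TopologicalSpace H] [ChartedSpace F H] [Group H] (R : ReductiveGroup F H)

/-- The semisimple component. -/
def ssPart (m : H) : H := (R.exists_isJordanChevalley m).choose

/-- The unipotent component. -/
def unipPart (m : H) : H := (R.exists_isJordanChevalley m).choose_spec.choose

theorem isJordanChevalley_parts (m : H) : R.IsJordanChevalley m (R.ssPart m) (R.unipPart m) :=
  (R.exists_isJordanChevalley m).choose_spec.choose_spec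

variable {R}

theorem IsJordanChevalley.unipPart_eq {m s u : H} (h : R.IsJordanChevalley m s u) :
    R.unipPart m = u :=
  ((R.isJordanChevalley_parts m).unique h).2

theorem IsJordanChevalley.ssPart_eq {m s u : H} (h : R.IsJordanChevalley m s u) :
    R.ssPart m = s :=
  ((R.isJordanChevalley_parts m).unique h).1

/-- Jordan components commute with whatever commutes with the element, so all four components
commute pairwise. -/
theorem IsJordanChevalley.mul {m s u m' s' u' : H} (h : R.IsJordanChevalley m s u)
    (h' : R.IsJordanChevalley m' s' u') (hc : Commute m m') :
    R.IsJordanChevalley (m * m') (s * s') (u * u') := by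
  obtain ⟨hms', hmu'⟩ := h'.commute hc
  obtain ⟨hs's, hs'u⟩ := h.commute hms'.symm
  obtain ⟨-, hu'u⟩ := h.commute hmu'.symm
  have hu's : Commute u' s := (h.commute hmu'.symm).1
  have hsu : Commute s u := h.2.2.2
  have hs'u' : Commute s' u' := h'.2.2.2
  refine ⟨h.1.mul h'.1 hs's.symm, h.2.1.mul h'.2.1 hu'u.symm, ?_, ?_⟩
  · rw [h.2.2.1, h'.2.2.1, mul_assoc, mul_assoc, ← mul_assoc u s', ← hs'u.eq, mul_assoc]
  · exact ((hsu.mul_right hu's.symm).mul_left (hs'u.mul_right hs'u')).eq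

theorem charpoly_mat_conj (R : ReductiveGroup F H) (m h : H) :
    (R.mat (h⁻¹ * m * h)).charpoly = (R.mat m).charpoly := by
  rw [mat_mul, Matrix.charpoly_mul_comm, mat_mul, ← mul_assoc, mat_mul_mat_inv, one_mul]

/-- Conjugate elements share a characteristic polynomial, so one polynomial computes both semisimple
parts, and polynomials are compatible with conjugation. -/
theorem IsJordanChevalley.conj {m s u : H} (hm : R.IsJordanChevalley m s u) (h : H) :
    R.IsJordanChevalley (h⁻¹ * m * h) (h⁻¹ * s * h) (h⁻¹ * u * h) := by
  obtain ⟨q, hq⟩ := R.exists_isJordanChevalley_polynomial (R.mat m).charpoly_monic.ne_zero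
  obtain ⟨s₁, u₁, h₁, hs₁⟩ := hq m rfl
  obtain ⟨rfl, rfl⟩ := hm.unique h₁
  obtain ⟨s₂, u₂, h₂, hs₂⟩ := hq (h⁻¹ * m * h) (R.charpoly_mat_conj m h)
  have e : s₂ = h⁻¹ * s * h := R.mat_injective (by
    rw [hs₂, mat_mul, mat_mul, aeval_conj (R.mat_inv_mul_mat h), ← hs₁, mat_mul, mat_mul])
  have e' : u₂ = h⁻¹ * u * h := by
    have h3 := h₂.2.2.1
    rw [e, hm.2.2.1] at h3
    have h4 : h⁻¹ * (s * u) * h = h⁻¹ * s * h * (h⁻¹ * u * h) := by group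
    rw [h4] at h3
    exact (mul_left_cancel h3).symm
  rwa [e, e'] at h₂

end ReductiveGroup

/-! ### The monodromy in frames and its unipotent part -/

section Monodromy

variable {E EG X G F H : Type*}
  [NormedAddCommGroup E] [NormedSpace ℂ E] [NormedAddCommGroup EG] [NormedSpace ℂ EG]
  [NormedAddCommGroup F] [NormedSpace ℂ F]
  [TopologicalSpace X] [ChartedSpace E X] [TopologicalSpace G] [ChartedSpace EG G]
  [TopologicalSpace H] [ChartedSpace F H] [Group H]
  {k : ℕ} [MulAction (Fin k → ℂˣ) X]
  {𝒢 : HomogeneousGroupoid E EG X G k} {P : PrincipalBundle.{w} E X F H}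

namespace RepOn

variable (φ : RepOn 𝒢.toHolLieGroupoid P)

theorem exists_monodromy_eq (n : Fin k → ℤ) (p : P.carrier) :
    ∃ m : H, monodromy 𝒢 φ n (P.proj p) = P.arrow (P.act p m) p := by
  obtain ⟨q, hq, hqt⟩ := φ.exists_eq_arrow (g := 𝒢.i (lattice n, P.proj p)) (𝒢.src_i _ _).symm
  rw [𝒢.tgt_i_lattice] at hqt
  obtain ⟨m, rfl⟩ := P.exists_act_eq hqt.symm
  exact ⟨m, hq⟩

/-- The monodromy in a frame. -/
def frameMonodromy (n : Fin k → ℤ) (p : P.carrier) : H := (φ.exists_monodromy_eq n p).choose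

theorem monodromy_eq (n : Fin k → ℤ) (p : P.carrier) :
    monodromy 𝒢 φ n (P.proj p) = P.arrow (P.act p (φ.frameMonodromy n p)) p :=
  (φ.exists_monodromy_eq n p).choose_spec

variable {φ} in
theorem frameMonodromy_eq {n : Fin k → ℤ} {p : P.carrier} {m : H}
    (h : monodromy 𝒢 φ n (P.proj p) = P.arrow (P.act p m) p) : φ.frameMonodromy n p = m :=
  P.act_injective (PrincipalBundle.arrow_left_injective ((φ.monodromy_eq n p).symm.trans h))

theorem frameMonodromy_act (n : Fin k → ℤ) (p : P.carrier) (h : H) :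
    φ.frameMonodromy n (P.act p h) = h⁻¹ * φ.frameMonodromy n p * h := by
  refine frameMonodromy_eq ?_
  rw [P.proj_act, φ.monodromy_eq, ← PrincipalBundle.arrow_act _ p h, ← P.act_mul, ← P.act_mul]
  congr 2
  group

theorem frameMonodromy_add (n n' : Fin k → ℤ) (p : P.carrier) :
    φ.frameMonodromy (n + n') p = φ.frameMonodromy n p * φ.frameMonodromy n' p := by
  refine frameMonodromy_eq ?_
  rw [monodromy, lattice_add, 𝒢.i_add, expTorus_lattice, one_smul, P.act_mul]
  refine φ.map_mul_eq ?_ ?_ (φ.monodromy_eq n' p)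
  · rw [𝒢.src_i, 𝒢.tgt_i_lattice]
  · rw [PrincipalBundle.arrow_act]
    exact φ.monodromy_eq n p

theorem commute_frameMonodromy (n n' : Fin k → ℤ) (p : P.carrier) :
    Commute (φ.frameMonodromy n p) (φ.frameMonodromy n' p) := by
  rw [Commute, SemiconjBy, ← frameMonodromy_add, ← frameMonodromy_add, add_comm]

/-- This is centrality of the lattice: applying φ to both sides of i(2πi n, t(g)) g = g i(2πi n,
s(g)) gives q·m_n(q) = q·m_n(p). -/
theorem frameMonodromy_invariant (n : Fin k → ℤ) {g : G} {q p : P.carrier}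
    (h : φ.toFun g = P.arrow q p) : φ.frameMonodromy n q = φ.frameMonodromy n p := by
  have hq : P.proj q = 𝒢.tgt g := by rw [← φ.tgt_toFun, h]; rfl
  have hp : P.proj p = 𝒢.src g := by rw [← φ.src_toFun, h]; rfl
  have h1 : φ.toFun (𝒢.mul (𝒢.i (lattice n, 𝒢.tgt g)) g) =
      P.arrow (P.act q (φ.frameMonodromy n q)) p := by
    refine φ.map_mul_eq (𝒢.src_i _ _) ?_ h
    rw [← hq]
    exact φ.monodromy_eq n q
  have h2 : φ.toFun (𝒢.mul g (𝒢.i (lattice n, 𝒢.src g))) =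
      P.arrow (P.act q (φ.frameMonodromy n p)) p := by
    refine φ.map_mul_eq (𝒢.tgt_i_lattice _ _).symm ?_ (q := P.act p (φ.frameMonodromy n p)) ?_
    · rw [PrincipalBundle.arrow_act, h]
    · rw [← hp]
      exact φ.monodromy_eq n p
  rw [𝒢.central, h2] at h1
  exact (P.act_injective (PrincipalBundle.arrow_left_injective h1)).symm

theorem contMDiff_frameMonodromy [LieGroup 𝓘(ℂ, F) ω H] (n : Fin k → ℤ) :
    ContMDiff (𝓘(ℂ, E).prod 𝓘(ℂ, F)) 𝓘(ℂ, F) ω (φ.frameMonodromy n) := by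
  intro p₀
  set γ : P.carrier → G := fun p => 𝒢.i (lattice n, P.proj p) with hγ
  have hγhol : ContMDiff (𝓘(ℂ, E).prod 𝓘(ℂ, F)) 𝓘(ℂ, EG) ω γ :=
    𝒢.i_holomorphic.comp (contMDiff_const.prodMk P.proj_holomorphic)
  obtain ⟨S, hS, hp₀, a, b, ha, hb, h⟩ := φ.holomorphic (γ p₀)
  have haγ := (ha.contMDiffAt (hS.mem_nhds hp₀)).comp p₀ hγhol.contMDiffAt
  have hbγ := (hb.contMDiffAt (hS.mem_nhds hp₀)).comp p₀ hγhol.contMDiffAt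
  have hnear : ∀ᶠ p in 𝓝 p₀, γ p ∈ S :=
    hγhol.continuous.continuousAt.preimage_mem_nhds (hS.mem_nhds hp₀)
  have hbp : ∀ p, γ p ∈ S → P.proj (b (γ p)) = P.proj p := by
    intro p hp
    have := φ.src_toFun (γ p)
    rw [h _ hp] at this
    exact this.trans (𝒢.src_i _ _)
  have hap : ∀ p, γ p ∈ S → P.proj (a (γ p)) = P.proj p := by
    intro p hp
    have := φ.tgt_toFun (γ p)
    rw [h _ hp] at this
    exact this.trans (𝒢.tgt_i_lattice _ _)
  -- A local lift [a, b] of the monodromy is renormalized to have second entry p: with d = b⁻¹p, the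
  -- first entry becomes a·d and m = p⁻¹(a·d).
  have h1 := P.contMDiffAt_div hbγ contMDiffAt_id (hnear.mono fun p hp => hbp p hp)
  have h2 := P.contMDiffAt_div contMDiffAt_id (P.contMDiffAt_act haγ h1)
    (hnear.mono fun p hp => by
      rw [P.proj_act]; exact (hap p hp).symm)
  refine h2.congr_of_eventuallyEq (hnear.mono fun p hp => ?_)
  refine frameMonodromy_eq ?_
  have h3 : P.proj p = P.proj (P.act (a (γ p)) (P.div (b (γ p)) p)) := by
    rw [P.proj_act]; exact (hap p hp).symm
  change φ.toFun (γ p) = P.arrow (P.act p (P.div p (P.act (a (γ p)) (P.div (b (γ p)) p)))) p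
  rw [P.act_div h3, h _ hp]
  exact PrincipalBundle.arrow_eq_iff.mpr ⟨_, rfl, (P.act_div (hbp p hp)).symm⟩

theorem charpoly_frameMonodromy_act (R : ReductiveGroup F H) (n : Fin k → ℤ) {p q : P.carrier}
    (h : P.proj p = P.proj q) :
    (R.mat (φ.frameMonodromy n p)).charpoly = (R.mat (φ.frameMonodromy n q)).charpoly := by
  obtain ⟨a, rfl⟩ := P.exists_act_eq h
  rw [φ.frameMonodromy_act, R.charpoly_mat_conj]

/-- The characteristic polynomial of the monodromy is constant on `X`. -/
theorem charpoly_frameMonodromy_eq [LieGroup 𝓘(ℂ, F) ω H] (R : ReductiveGroup F H)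
    (n : Fin k → ℤ) (p q : P.carrier) :
    (R.mat (φ.frameMonodromy n p)).charpoly = (R.mat (φ.frameMonodromy n q)).charpoly := by
  choose σ hσ using P.exists_proj_eq
  have hσ' : ∀ p, (R.mat (φ.frameMonodromy n (σ (P.proj p)))).charpoly =
      (R.mat (φ.frameMonodromy n p)).charpoly := fun p =>
    φ.charpoly_frameMonodromy_act R n (hσ _)
  refine Polynomial.funext fun l => ?_
  set f : X → ℂ := fun x => (R.mat (φ.frameMonodromy n (σ x))).charpoly.eval l with hf
  suffices h : f (P.proj p) = f (P.proj q) by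
    simpa only [hf, hσ'] using h
  have hFc : Continuous fun p => (R.mat (φ.frameMonodromy n p)).charpoly.eval l := by
    simp only [Matrix.eval_charpoly]
    refine Continuous.matrix_det (continuous_const.sub ?_)
    refine continuous_matrix fun i j => continuous_iff_continuousAt.mpr fun p => ?_
    exact ((R.contMDiffAt_iff.mp (φ.contMDiff_frameMonodromy n p)) i j).continuousAt
  -- The choice σ of frames need not be continuous; near each point it is replaced by a continuous
  -- local section, which leaves the conjugation-invariant f unchanged.
  have hfc : Continuous f := by
    refine continuous_iff_continuousAt.mpr fun x => ?_
    obtain ⟨W, hW, hxW, t, -, htgt, hpr, -⟩ := P.locally_trivial x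
    have hmem : ∀ y ∈ W, (y, (1 : H)) ∈ t.target := fun y hy => by rw [htgt]; exact ⟨hy, trivial⟩
    have h1 : ContinuousAt (fun y : X => t.symm (y, (1 : H))) x :=
      ContinuousAt.comp (f := fun y : X => (y, (1 : H)))
        (t.symm.continuousAt (x := (x, (1 : H))) (hmem x hxW))
        (by fun_prop)
    refine (ContinuousAt.comp (f := fun y : X => t.symm (y, (1 : H)))
      hFc.continuousAt h1).congr ?_
    filter_upwards [hW.mem_nhds hxW] with y hy
    have hy' : P.proj (t.symm (y, 1)) = y := by
      rw [← hpr _ (t.map_target (hmem y hy)), t.right_inv (hmem y hy)]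
    simp only [hf, Function.comp]
    rw [φ.charpoly_frameMonodromy_act R n (hy'.trans (hσ y).symm)]
  -- Constancy spreads from orbits to their closures by continuity, and across intersecting closures
  -- to the whole s-equivalence class.
  have horb : ∀ x, ∀ y ∈ 𝒢.orbit x, f y = f x := by
    rintro _ _ ⟨g, rfl, rfl⟩
    obtain ⟨q, hq, hqt⟩ := φ.exists_eq_arrow (hσ (𝒢.src g))
    simp only [hf]
    rw [φ.charpoly_frameMonodromy_act R n ((hσ _).trans hqt.symm),
      φ.frameMonodromy_invariant n hq]
  have hcl : ∀ x, ∀ y ∈ closure (𝒢.orbit x), f y = f x := fun x =>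
    closure_minimal (horb x) (isClosed_eq hfc continuous_const)
  have hall : ∀ x y, 𝒢.SEquiv x y → f x = f y := by
    intro x y h
    induction h with
    | rel x y h =>
      obtain ⟨z, hzx, hzy⟩ := h
      rw [← hcl x z hzx, hcl y z hzy]
    | refl x => rfl
    | symm x y _ ih => exact ih.symm
    | trans x y z _ _ ih ih' => exact ih.trans ih'
  exact hall _ _ (𝒢.sEquiv_unique _ _)

/-- The unipotent part of the monodromy. -/
def unipotentMonodromy [LieGroup 𝓘(ℂ, F) ω H] (R : ReductiveGroup F H) :
    UnipotentFamily R φ where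
  u n p := R.unipPart (φ.frameMonodromy n p)
  map_add n n' p := by
    rw [φ.frameMonodromy_add]
    exact ((R.isJordanChevalley_parts _).mul (R.isJordanChevalley_parts _)
      (φ.commute_frameMonodromy n n' p)).unipPart_eq
  conj n p h := by
    rw [φ.frameMonodromy_act]
    exact ((R.isJordanChevalley_parts _).conj h).unipPart_eq
  holomorphic n p₀ := by
    -- The characteristic polynomial is the same in all frames, so this single q gives a holomorphic
    -- semisimple part s, and the unipotent part is s⁻¹m.
    obtain ⟨q, hq⟩ := R.exists_isJordanChevalley_polynomial
      (R.mat (φ.frameMonodromy n p₀)).charpoly_monic.ne_zero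
    have hs : ∀ p, R.mat (R.ssPart (φ.frameMonodromy n p)) =
        Polynomial.aeval (R.mat (φ.frameMonodromy n p)) q := by
      intro p
      obtain ⟨s, u, h, hs⟩ := hq _ (φ.charpoly_frameMonodromy_eq R n p p₀)
      rw [h.ssPart_eq, hs]
    have hm := φ.contMDiff_frameMonodromy n p₀
    have hs' : ContMDiffAt (𝓘(ℂ, E).prod 𝓘(ℂ, F)) 𝓘(ℂ, F) ω
        (fun p => R.ssPart (φ.frameMonodromy n p)) p₀ := by
      rw [R.contMDiffAt_iff]
      simp only [hs]
      exact MatHolAt.aeval (R.contMDiffAt_iff.mp hm) q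
    have e : (fun p => R.unipPart (φ.frameMonodromy n p)) =
        fun p => (R.ssPart (φ.frameMonodromy n p))⁻¹ * φ.frameMonodromy n p := by
      funext p
      rw [eq_inv_mul_iff_mul_eq]
      exact (R.isJordanChevalley_parts (φ.frameMonodromy n p)).2.2.1.symm
    rw [e]
    exact hs'.inv.mul hm
  invariant n g q p h := by rw [φ.frameMonodromy_invariant n h]
  unipotent n p := (R.isJordanChevalley_parts _).2.1

end RepOn

end Monodromy

/-! ### The isomorphism of categories -/

section Functors

variable {E EG X G F H : Type*}
  [NormedAddCommGroup E] [NormedSpace ℂ E] [NormedAddCommGroup EG] [NormedSpace ℂ EG]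
  [NormedAddCommGroup F] [NormedSpace ℂ F]
  [TopologicalSpace X] [ChartedSpace E X] [TopologicalSpace G] [ChartedSpace EG G]
  [TopologicalSpace H] [ChartedSpace F H] [Group H]
  {k : ℕ} [MulAction (Fin k → ℂˣ) X]

theorem GRep.hom_ext {𝒢 : HolLieGroupoid E EG X G} {A B : GRep.{w} F H 𝒢} {f f' : A ⟶ B}
    (h : ∀ p, f.map.toFun p = f'.map.toFun p) : f = f' :=
  GRep.Hom.ext (PrincipalBundle.Hom.ext (funext h))

theorem GRep.autFun_mul {𝒢 : HolLieGroupoid E EG X G} {A : GRep.{w} F H 𝒢} (u v : Aut A)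
    (p : A.P.carrier) : GRep.autFun (u * v) p = GRep.autFun u (GRep.autFun v p) := rfl

/-- Strict equality of functors compares morphisms between objects that are only provably equal; the
underlying bundle maps decide it. -/
theorem GRep.hom_heq {𝒢 : HolLieGroupoid E EG X G} {A A' B B' : GRep.{w} F H 𝒢} (hA : A = A')
    (hB : B = B') {f : A ⟶ B} {f' : A' ⟶ B'} (h : HEq f.map f'.map) : HEq f f' := by
  subst hA hB
  exact heq_of_eq (GRep.Hom.ext (eq_of_heq h))

theorem JC.hom_heq {𝒢 : HomogeneousGroupoid E EG X G k} {R : ReductiveGroup F H}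
    {A A' B B' : JC.{w} 𝒢 R} (hA : A = A') (hB : B = B') {f : A ⟶ B} {f' : A' ⟶ B'}
    (h : HEq f.map.map f'.map.map) : HEq f f' := by
  subst hA hB
  exact heq_of_eq (JC.Hom.ext (GRep.Hom.ext (eq_of_heq h)))

theorem JC.obj_ext {𝒢 : HomogeneousGroupoid E EG X G k} {R : ReductiveGroup F H}
    {P : PrincipalBundle.{w} E X F H} {φ φ' : RepOn 𝒢.toHolLieGroupoid P}
    {hs : HasSemisimpleMonodromy 𝒢 R φ} {hs' : HasSemisimpleMonodromy 𝒢 R φ'}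
    {U : Multiplicative (Fin k → ℤ) →* Aut (GRep.mk P φ)}
    {U' : Multiplicative (Fin k → ℤ) →* Aut (GRep.mk P φ')}
    {hU : ∀ n, IsUnipotentAut R (U n)} {hU' : ∀ n, IsUnipotentAut R (U' n)} (hφ : φ = φ')
    (h : ∀ n p, GRep.autFun (U n) p = GRep.autFun (U' n) p) :
    JC.mk ⟨P, φ⟩ hs U hU = JC.mk ⟨P, φ'⟩ hs' U' hU' := by
  subst hφ
  have : U = U' := MonoidHom.ext fun n => Iso.ext (GRep.hom_ext (h n))
  subst this
  rfl

namespace UnipotentFamily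

variable {𝒢 : HomogeneousGroupoid E EG X G k} {R : ReductiveGroup F H}
  {P : PrincipalBundle.{w} E X F H} {φ : RepOn 𝒢.toHolLieGroupoid P}
  (W : UnipotentFamily R φ)

/-- The bundle map `p ↦ p · u n p` as an endomorphism of the representation. -/
def hom (n : Fin k → ℤ) : GRep.mk P φ ⟶ GRep.mk P φ :=
  GRep.Hom.mk
    (PrincipalBundle.Hom.mk (fun p => P.act p (W.u n p))
      (fun p => P.contMDiffAt_act contMDiffAt_id (W.holomorphic n p))
      (fun p => P.proj_act _ _)
      (fun p h => by
        rw [W.conj, ← P.act_mul, ← P.act_mul]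
        congr 1
        group))
    (fun g q p h => by
      change φ.toFun g = P.arrow (P.act q (W.u n q)) (P.act p (W.u n p))
      rw [W.invariant n g q p h, PrincipalBundle.arrow_act]
      exact h)

theorem hom_comp_hom (n n' : Fin k → ℤ) : W.hom n ≫ W.hom n' = W.hom (n' + n) := by
  refine GRep.hom_ext fun p => ?_
  change P.act (P.act p (W.u n p)) (W.u n' (P.act p (W.u n p))) = P.act p (W.u (n' + n) p)
  rw [W.conj_of_commute (W.commute _ _ _), ← P.act_mul, ← W.map_add, add_comm]

theorem hom_zero : W.hom 0 = 𝟙 _ := by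
  refine GRep.hom_ext fun p => ?_
  change P.act p (W.u 0 p) = p
  rw [W.map_zero, P.act_one]

/-- The automorphisms `p ↦ p · u n p` of the representation. -/
def autHom : Multiplicative (Fin k → ℤ) →* Aut (GRep.mk P φ) where
  toFun n :=
    { hom := W.hom n.toAdd
      inv := W.hom (-n.toAdd)
      hom_inv_id := by rw [hom_comp_hom, neg_add_cancel, hom_zero]
      inv_hom_id := by rw [hom_comp_hom, add_neg_cancel, hom_zero] }
  map_one' := Iso.ext W.hom_zero
  map_mul' n n' := Iso.ext (W.hom_comp_hom n'.toAdd n.toAdd).symm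

theorem autFun_autHom (n : Multiplicative (Fin k → ℤ)) (p : P.carrier) :
    GRep.autFun (W.autHom n) p = P.act p (W.u n.toAdd p) := rfl

theorem isUnipotentAut_autHom (n : Multiplicative (Fin k → ℤ)) :
    IsUnipotentAut R (W.autHom n) := by
  intro p h e
  rw [autFun_autHom] at e
  rw [← P.act_injective e]
  exact W.unipotent _ _

/-- A bundle map that preserves the family in frames preserves the exponential section, which makes
twisting functorial. -/
theorem twist_intertwines {P' : PrincipalBundle.{w} E X F H} {φ' : RepOn 𝒢.toHolLieGroupoid P'}
    (W' : UnipotentFamily R φ') (f : GRep.mk P φ ⟶ GRep.mk P' φ')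
    (hu : ∀ n p, W'.u n (f.map.toFun p) = W.u n p) {g : G} {q p : P.carrier}
    (h : W.twist.toFun g = P.arrow q p) :
    W'.twist.toFun g = P'.arrow (f.map.toFun q) (f.map.toFun p) := by
  have hp : P.proj p = 𝒢.src g := by rw [← W.twist.src_toFun, h]; rfl
  obtain ⟨q₀, hq₀, -⟩ := φ.exists_eq_arrow hp
  rw [W.twist_eq hq₀] at h
  have hc : W'.coc g (f.map.toFun q₀) = W.coc g q₀ := by
    refine W'.coc_eq ?_
    simp only [hu]
    exact W.isExpLog_coc g q₀
  rw [← PrincipalBundle.arrow_left_injective h, W'.twist_eq (f.intertwines g q₀ p hq₀), hc]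
  exact congrArg (fun r => P'.arrow r (f.map.toFun p)) (f.map.toFun_act q₀ (W.coc g q₀)).symm

end UnipotentFamily

variable {𝒢 : HomogeneousGroupoid E EG X G k} {R : ReductiveGroup F H}

namespace RepOn

variable {P : PrincipalBundle.{w} E X F H} (φ : RepOn 𝒢.toHolLieGroupoid P)

theorem frameMonodromy_map {P' : PrincipalBundle.{w} E X F H}
    {φ' : RepOn 𝒢.toHolLieGroupoid P'} (f : GRep.mk P φ ⟶ GRep.mk P' φ') (n : Fin k → ℤ)
    (p : P.carrier) : φ'.frameMonodromy n (f.map.toFun p) = φ.frameMonodromy n p := by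
  refine frameMonodromy_eq ?_
  have h1 : P'.proj (f.map.toFun p) = P.proj p := f.map.proj_toFun p
  have h2 : f.map.toFun (P.act p (φ.frameMonodromy n p)) =
      P'.act (f.map.toFun p) (φ.frameMonodromy n p) := f.map.toFun_act _ _
  rw [h1, ← h2]
  exact f.intertwines _ _ _ (φ.monodromy_eq n p)

variable [LieGroup 𝓘(ℂ, F) ω H]

variable (R) in
/-- The representation `φ_s = σ_U φ`. -/
def semisimplePart : RepOn 𝒢.toHolLieGroupoid P := (φ.unipotentMonodromy R).twist

variable (R) in
/-- The automorphisms `U` of `φ_s`. -/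
def unipotentFamily : UnipotentFamily R (φ.semisimplePart R) :=
  (φ.unipotentMonodromy R).transfer (φ.unipotentMonodromy R)
    (φ.unipotentMonodromy R).commute

theorem monodromy_semisimplePart (n : Fin k → ℤ) (p : P.carrier) :
    monodromy 𝒢 (φ.semisimplePart R) n (P.proj p) =
      P.arrow (P.act p (R.ssPart (φ.frameMonodromy n p))) p := by
  refine ((φ.unipotentMonodromy R).monodromy_twist (φ.monodromy_eq n p)).trans ?_
  congr 2
  exact mul_inv_eq_of_eq_mul (R.isJordanChevalley_parts (φ.frameMonodromy n p)).2.2.1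

theorem hasSemisimpleMonodromy_semisimplePart :
    HasSemisimpleMonodromy 𝒢 R (φ.semisimplePart R) := by
  intro n p m h
  rw [φ.monodromy_semisimplePart n p] at h
  rw [← P.act_injective (PrincipalBundle.arrow_left_injective h)]
  exact (R.isJordanChevalley_parts _).1

end RepOn

variable [LieGroup 𝓘(ℂ, F) ω H]

namespace JC

/-- The unipotent automorphisms of a Jordan–Chevalley triple, in frames. -/
def family (J : JC.{w} 𝒢 R) : UnipotentFamily R J.rep.φ :=
  have hproj : ∀ n p, J.rep.P.proj p = J.rep.P.proj (GRep.autFun (J.U n) p) := fun n p =>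
    ((J.U n).hom.map.proj_toFun p).symm
  have hact : ∀ n p h, GRep.autFun (J.U n) (J.rep.P.act p h) =
      J.rep.P.act (GRep.autFun (J.U n) p) h := fun n p h => (J.U n).hom.map.toFun_act p h
  have hconj : ∀ n p h, J.rep.P.div (J.rep.P.act p h) (GRep.autFun (J.U n) (J.rep.P.act p h)) =
      h⁻¹ * J.rep.P.div p (GRep.autFun (J.U n) p) * h := fun n p h => by
    refine J.rep.P.act_injective (p := J.rep.P.act p h) ?_
    rw [J.rep.P.act_div (hproj _ _), hact, ← J.rep.P.act_mul, mul_assoc, mul_inv_cancel_left,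
      J.rep.P.act_mul, J.rep.P.act_div (hproj _ _)]
  { u := fun n p => J.rep.P.div p (GRep.autFun (J.U (Multiplicative.ofAdd n)) p)
    map_add := fun n n' p => by
      refine J.rep.P.act_injective (p := p) ?_
      rw [J.rep.P.act_div (hproj _ _), ofAdd_add, _root_.map_mul, GRep.autFun_mul,
        J.rep.P.act_mul, J.rep.P.act_div (hproj _ _), ← hact, J.rep.P.act_div (hproj _ _)]
    conj := fun n p h => hconj _ p h
    holomorphic := fun n p => J.rep.P.contMDiffAt_div contMDiffAt_id
      ((J.U (Multiplicative.ofAdd n)).hom.map.holomorphic p)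
      (Filter.Eventually.of_forall fun p => hproj _ p)
    invariant := fun n g q p h => by
      -- U_n is an automorphism of φ_s, so [q, p] = [U_n q, U_n p]; freeness of the action forces
      -- one group element at both ends.
      have h1 : J.rep.φ.toFun g = J.rep.P.arrow (GRep.autFun (J.U (Multiplicative.ofAdd n)) q)
        (GRep.autFun (J.U (Multiplicative.ofAdd n)) p) :=
          (J.U (Multiplicative.ofAdd n)).hom.intertwines g q p h
      rw [h] at h1
      obtain ⟨a, hq, hp⟩ := PrincipalBundle.arrow_eq_iff.mp h1
      rw [hq, hp, J.rep.P.div_act, J.rep.P.div_act]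
    unipotent := fun n p => J.unipotent _ p _ (J.rep.P.act_div (hproj _ _)).symm }

theorem act_family (J : JC.{w} 𝒢 R) (n : Fin k → ℤ) (p : J.rep.P.carrier) :
    GRep.autFun (J.U (Multiplicative.ofAdd n)) p = J.rep.P.act p (J.family.u n p) :=
  (J.rep.P.act_div ((J.U (Multiplicative.ofAdd n)).hom.map.proj_toFun p).symm).symm

theorem family_eq (J : JC.{w} 𝒢 R) {n : Fin k → ℤ} {p : J.rep.P.carrier} {h : H}
    (e : GRep.autFun (J.U (Multiplicative.ofAdd n)) p = J.rep.P.act p h) :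
    J.family.u n p = h :=
  J.rep.P.act_injective ((J.act_family n p).symm.trans e)

theorem family_map {J J' : JC.{w} 𝒢 R} (f : J ⟶ J') (n : Fin k → ℤ) (p : J.rep.P.carrier) :
    J'.family.u n (f.map.map.toFun p) = J.family.u n p := by
  refine J'.family_eq ?_
  have h := congrArg (fun a : J.rep ⟶ J'.rep => a.map.toFun p)
    (f.intertwines (Multiplicative.ofAdd n))
  change f.map.map.toFun (GRep.autFun (J.U (Multiplicative.ofAdd n)) p) =
    GRep.autFun (J'.U (Multiplicative.ofAdd n)) (f.map.map.toFun p) at h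
  rw [← h, J.act_family]
  exact f.map.map.toFun_act p _

theorem autFun_inv (J : JC.{w} 𝒢 R) (n : Fin k → ℤ) (p : J.rep.P.carrier) :
    GRep.autFun (J.U (Multiplicative.ofAdd n))⁻¹ p = J.rep.P.act p (J.family.inv.u n p) := by
  rw [← _root_.map_inv, ← ofAdd_neg, act_family]
  congr 1
  exact eq_inv_of_mul_eq_one_left (by rw [← J.family.map_add, neg_add_cancel, J.family.map_zero])

/-- The unipotent part of the monodromy of `σ_{U⁻¹} φ_s` is `U`. -/
theorem unipotentMonodromy_twist (J : JC.{w} 𝒢 R) (n : Fin k → ℤ) (p : J.rep.P.carrier) :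
    (J.family.inv.twist.unipotentMonodromy R).u n p = J.family.u n p := by
  have h1 := J.rep.φ.monodromy_eq n p
  set s := J.rep.φ.frameMonodromy n p with hs
  have h2 := J.family.inv.monodromy_twist h1
  -- Invariance of U under the monodromy arrow [p·s, p] reads s⁻¹ u s = u.
  have hc : s * J.family.u n p = J.family.u n p * s := by
    have h3 := J.family.invariant n _ _ _ h1
    rw [J.family.conj, mul_assoc, inv_mul_eq_iff_eq_mul] at h3
    exact h3.symm
  have h4 : R.IsJordanChevalley (s * J.family.u n p) s (J.family.u n p) :=
    ⟨J.semisimple n p s h1, J.family.unipotent n p, rfl, hc⟩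
  -- Twisting by U⁻¹ multiplies the monodromy by (u⁻¹)⁻¹, so it becomes s u, already in Jordan form.
  have h5 : J.family.inv.twist.frameMonodromy n p = s * J.family.u n p := by
    rw [RepOn.frameMonodromy_eq h2]
    congr 1
    exact inv_inv _
  change R.unipPart _ = _
  rw [h5, h4.unipPart_eq]

end JC

variable (𝒢 R)

/-- The functor `T (P, φ) = (P, φ_s, U)`. -/
def jordanFunctor : GRep.{w} F H 𝒢.toHolLieGroupoid ⥤ JC.{w} 𝒢 R where
  obj A := ⟨⟨A.P, A.φ.semisimplePart R⟩, A.φ.hasSemisimpleMonodromy_semisimplePart,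
    (A.φ.unipotentFamily R).autHom, (A.φ.unipotentFamily R).isUnipotentAut_autHom⟩
  map {A B} f :=
    have hu : ∀ n p, (B.φ.unipotentMonodromy R).u n (f.map.toFun p) =
        (A.φ.unipotentMonodromy R).u n p := fun n p =>
      congrArg R.unipPart (A.φ.frameMonodromy_map f n p)
    JC.Hom.mk
      (GRep.Hom.mk f.map fun _ _ _ h =>
        (A.φ.unipotentMonodromy R).twist_intertwines (B.φ.unipotentMonodromy R) f hu h)
      (fun n => GRep.hom_ext fun p => by
        change f.map.toFun (A.P.act p ((A.φ.unipotentMonodromy R).u n.toAdd p)) =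
          B.P.act (f.map.toFun p) ((B.φ.unipotentMonodromy R).u n.toAdd (f.map.toFun p))
        rw [hu]
        exact f.map.toFun_act _ _)
  map_id _ := rfl
  map_comp _ _ := rfl

/-- The functor `T' (P, φ_s, U) = (P, σ_{U⁻¹} φ_s)`. -/
def jordanInverse : JC.{w} 𝒢 R ⥤ GRep.{w} F H 𝒢.toHolLieGroupoid where
  obj J := ⟨J.rep.P, J.family.inv.twist⟩
  map {J J'} f := GRep.Hom.mk f.map.map fun _ _ _ h =>
    J.family.inv.twist_intertwines J'.family.inv f.map
      (fun n p => congrArg (·⁻¹) (JC.family_map f n p)) h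
  map_id _ := rfl
  map_comp _ _ := rfl

theorem jordanFunctor_comp_jordanInverse :
    jordanFunctor.{w} 𝒢 R ⋙ jordanInverse 𝒢 R = 𝟭 _ := by
  have hobj : ∀ A, (jordanFunctor.{w} 𝒢 R ⋙ jordanInverse 𝒢 R).obj A = A := by
    rintro ⟨P, φ⟩
    refine congrArg (GRep.mk P) ?_
    -- The family read off from the triple is the unipotent monodromy that defined the first twist,
    -- so the second twist undoes it.
    refine UnipotentFamily.twist_twist_of_inv _ _ fun n p => congrArg (·⁻¹) ?_
    exact JC.family_eq _ rfl
  exact Functor.hext hobj fun A B f => GRep.hom_heq (hobj A) (hobj B) HEq.rfl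

theorem jordanInverse_comp_jordanFunctor :
    jordanInverse.{w} 𝒢 R ⋙ jordanFunctor 𝒢 R = 𝟭 _ := by
  have hobj : ∀ J, (jordanInverse.{w} 𝒢 R ⋙ jordanFunctor 𝒢 R).obj J = J := by
    intro J
    refine JC.obj_ext (P := J.rep.P) (φ' := J.rep.φ) (hs' := J.semisimple) (U' := J.U)
      (hU' := J.unipotent) ?_ fun n p => ?_
    -- Recovering U from the monodromy of the twist settles both the representation and the
    -- automorphisms.
    · refine UnipotentFamily.twist_twist_of_inv J.family.inv _ fun n p => ?_
      refine (J.unipotentMonodromy_twist n p).trans ?_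
      exact (inv_inv _).symm
    · refine Eq.trans ?_ (J.act_family n.toAdd p).symm
      exact congrArg (J.rep.P.act p) (J.unipotentMonodromy_twist n.toAdd p)
  exact Functor.hext hobj fun A B f => JC.hom_heq (hobj A) (hobj B) HEq.rfl

end Functors

end JCDec

end

theorem mainTheorem3
    {E EG F X G H : Type*}
    [NormedAddCommGroup E] [NormedSpace ℂ E] [FiniteDimensional ℂ E]
    [NormedAddCommGroup EG] [NormedSpace ℂ EG] [FiniteDimensional ℂ EG]
    [NormedAddCommGroup F] [NormedSpace ℂ F] [FiniteDimensional ℂ F]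
    [TopologicalSpace X] [ChartedSpace E X] [IsManifold 𝓘(ℂ, E) ω X]
    [TopologicalSpace G] [ChartedSpace EG G] [IsManifold 𝓘(ℂ, EG) ω G]
    [TopologicalSpace H] [ChartedSpace F H] [Group H] [LieGroup 𝓘(ℂ, F) ω H] [ConnectedSpace H]
    {k : ℕ} [MulAction (Fin k → ℂˣ) X]
    (𝒢 : HomogeneousGroupoid E EG X G k) (R : ReductiveGroup F H) :
    ∃ (T : GRep.{w} F H 𝒢.toHolLieGroupoid ⥤ JC.{w} 𝒢 R)
      (T' : JC.{w} 𝒢 R ⥤ GRep.{w} F H 𝒢.toHolLieGroupoid),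
      -- `T` and `T'` are mutually inverse, so that `T` is an isomorphism of categories
      T ⋙ T' = 𝟭 _ ∧ T' ⋙ T = 𝟭 _ ∧
      -- `T` is the identity on underlying bundles and bundle maps
      T ⋙ JC.forget = GRep.forget ∧
      -- `T (P, φ) = (P, σ_U φ, U)` with `U` the unipotent part of the monodromy `M` of `φ`,
      -- and the monodromy of `σ_U φ` is the semisimple part of `M`
      (∀ (P : PrincipalBundle.{w} E X F H) (φ : RepOn 𝒢.toHolLieGroupoid P),
        ∃ (φs : RepOn 𝒢.toHolLieGroupoid P) (hs : HasSemisimpleMonodromy 𝒢 R φs)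
          (U : Multiplicative (Fin k → ℤ) →* Aut (GRep.mk P φs))
          (hU : ∀ n, IsUnipotentAut R (U n)),
          T.obj ⟨P, φ⟩ = ⟨⟨P, φs⟩, hs, U, hU⟩ ∧
          (∀ (n : Fin k → ℤ) (p : P.carrier), ∃ m s u : H,
            R.IsJordanChevalley m s u ∧
            monodromy 𝒢 φ n (P.proj p) = P.arrow (P.act p m) p ∧
            monodromy 𝒢 φs n (P.proj p) = P.arrow (P.act p s) p ∧
            GRep.autFun (U (Multiplicative.ofAdd n)) p = P.act p u) ∧
          IsTwist 𝒢 R (fun n => GRep.autFun (U (Multiplicative.ofAdd n))) φ φs) ∧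
      -- `T' (P, φ_s, U) = (P, σ_{U⁻¹} φ_s)`
      (∀ J : JC.{w} 𝒢 R, ∃ φ : RepOn 𝒢.toHolLieGroupoid J.rep.P,
        T'.obj J = ⟨J.rep.P, φ⟩ ∧
        IsTwist 𝒢 R (fun n => GRep.autFun (J.U (Multiplicative.ofAdd n))⁻¹) J.rep.φ φ) := by
  refine ⟨jordanFunctor 𝒢 R, jordanInverse 𝒢 R, jordanFunctor_comp_jordanInverse 𝒢 R,
    jordanInverse_comp_jordanFunctor 𝒢 R, rfl, fun P φ => ?_, fun J => ?_⟩
  · refine ⟨φ.semisimplePart R, φ.hasSemisimpleMonodromy_semisimplePart,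
      (φ.unipotentFamily R).autHom, (φ.unipotentFamily R).isUnipotentAut_autHom, rfl,
      fun n p => ?_, ?_⟩
    · exact ⟨φ.frameMonodromy n p, R.ssPart _, R.unipPart _, R.isJordanChevalley_parts _,
        φ.monodromy_eq n p, φ.monodromy_semisimplePart n p, rfl⟩
    · exact (φ.unipotentMonodromy R).isTwist fun n q => rfl
  · exact ⟨J.family.inv.twist, rfl, J.family.inv.isTwist fun n q => J.autFun_inv n q⟩
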